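/- **Setting.** All vector spaces are real and finite-dimensional. A scalar product is a non-degenerate symmetric bilinear form, possibly indefinite, and a subspace is *non-degenerate* if the form restricted to it is ($0$ is non-degenerate). A Lie algebra with involution is a pair $(\mathfrak l,\theta)$ with $\theta$ an automorphism, $\theta^2=\mathrm{id}$. An orthogonal $(\mathfrak l,\theta)$-module is an $\mathfrak l$-module $(\rho,\mathfrak a)$ with a scalar product for which all $\rho(L)$ are skew, and an isometry $\theta_{\mathfrak a}$ of $\mathfrak a$ with $\theta_{\mathfrak a}^2=\mathrm{id}$ and $\theta_{\mathfrak a}\rho(\theta L)=\rho(L)\theta_{\mathfrak a}$. Subscripts $\pm$ denote $\pm1$-eigenspaces of the involutions, $\mathfrak a^{\mathfrak l}$ the invariants, $\mathfrak a_{\mathbb C}$ the complexification. **Quadratic cohomology.** Let $C^p(\mathfrak l,\mathfrak a)$, $C^p(\mathfrak l)$ be the alternating $p$-linear maps with values in $\mathfrak a$, resp. the trivial module $\mathbb R$, with the Chevalley–Eilenberg differentials $d$, and let $\langle\cdot\wedge\cdot\rangle$ be the wedge product composed with the scalar product. The involutions act by $(\Theta\alpha)(L_1,\dots)=\theta_{\mathfrak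 a}\alpha(\theta L_1,\dots)$ and $(\Theta\gamma)(L_1,\dots)=\gamma(\theta L_1,\dots)$; the subscript $+$ denotes $\Theta$-invariants. Let $\mathcal Z_+$ be the set of $(\alpha,\gamma)\in C^2(\mathfrak l,\mathfrak a)_+\oplus C^3(\mathfrak l)_+$ with $d\alpha=0$, $d\gamma=\frac12\langle\alpha\wedge\alpha\rangle$. The group $C^1(\mathfrak l,\mathfrak a)_+\oplus C^2(\mathfrak l)_+$ with $(\tau_1,\sigma_1)*(\tau_2,\sigma_2)=(\tau_1+\tau_2,\sigma_1+\sigma_2+\frac12\langle\tau_1\wedge\tau_2\rangle)$ acts on it by $$(\alpha,\gamma)(\tau,\sigma)=\big(\alpha+d\tau,\ \gamma+d\sigma+\langle(\alpha+\tfrac12d\tau)\wedge\tau\rangle\big).$$ $\mathcal H^2_Q(\mathfrak l,\theta,\mathfrak a)$ is the set of orbits $[\alpha,\gamma]$. **Admissible classes.** Let $R_0=\mathfrak l$, let $R_{k+1}\subset R_k$ be the smallest ideal of $\mathfrak l$ such that the $\mathfrak l$-module $R_k/R_{k+1}$ is semi-simple, and let $S$ be the largest ideal that is semi-simple as an $\mathfrak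 l$-module. Assume $[\mathfrak l_-,\mathfrak l_-]=\mathfrak l_+$ and that $\mathfrak a$ is semi-simple; then $\mathfrak a=\mathfrak a^{\mathfrak l}\oplus\rho(\mathfrak l)\mathfrak a$, and $\alpha_0$ denotes the $\mathfrak a^{\mathfrak l}$-component of $\alpha$. Regard $\alpha_0$ and the bracket as linear maps on $\bigwedge^2\mathfrak l$. The class $[\alpha,\gamma]$ is *admissible* if the following hold. * $(T_2)$ $\mathfrak a^{\mathfrak l}_+=\alpha_0\big(\ker([\cdot,\cdot]|_{\bigwedge^2\mathfrak l_-})\big)$. * $(A_0)$ If $L_0\in\mathfrak z(\mathfrak l)\cap\ker\rho$ and there are $A_0\in\mathfrak a$, $Z_0\in\mathfrak l^*$ with $\alpha(L,L_0)=\rho(L)A_0$ and $\gamma(L,L_0,\cdot)=-\langle A_0,\alpha(L,\cdot)\rangle+Z_0([L,\cdot])$ for all $L\in\mathfrak l$, then $L_0=0$. * $(B_0)$ $\alpha_0(\ker[\cdot,\cdot])$ is non-degenerate. * $(A_k)$, $k\ge1$: If $\mathfrak k\subset S\cap R_k$ is an ideal of $\mathfrak l$ and there are linear maps $\Phi_1:\mathfrak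 k\to\mathfrak a$, $\Phi_2:\mathfrak k\to R_k^*$ such that for all $L\in\mathfrak l$, $K\in\mathfrak k$ one has $\alpha(L,K)=\rho(L)\Phi_1(K)-\Phi_1([L,K])$ and, on $R_k$, $\gamma(L,K,\cdot)=-\langle\Phi_1(K),\alpha(L,\cdot)\rangle+\Phi_2(K)([L,\cdot])+\Phi_2([L,K])$, then $\mathfrak k=0$. * $(B_k)$, $k\ge1$: Let $\mathfrak b_k\subset\mathfrak a$ be the largest submodule for which there is a linear map $\Phi:R_k\to\mathfrak a$ with $\langle\alpha(L,K),B\rangle=\langle\rho(L)\Phi(K)-\Phi([L,K]),B\rangle$ for all $L\in\mathfrak l$, $K\in R_k$, $B\in\mathfrak b_k$. Then $\mathfrak b_k$ is non-degenerate. **Indecomposable classes.** A morphism $(q,j):(\mathfrak l,\theta,\mathfrak a)\to(\mathfrak l',\theta',\mathfrak a')$ consists of a Lie algebra homomorphism $q:\mathfrak l\to\mathfrak l'$ and an isometric embedding $j:\mathfrak a'\to\mathfrak a$, both commuting with the involutions, such that $j\circ\rho'(q(L))=\rho(L)\circ j$. It pulls back $(\alpha',\gamma')$ to $(j\circ q^*\alpha',q^*\gamma')$.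 The class $\varphi$ is *decomposable* if there are two non-zero morphisms $(q_i,j_i)$ to triples $(\mathfrak l_i,\theta_i,\mathfrak a_i)$, $i=1,2$, such that $(q_1,j_1)\oplus(q_2,j_2)$ is an isomorphism onto the direct sum of the two triples (with $\mathfrak a_1\perp\mathfrak a_2$), and classes $\varphi_i\in\mathcal H^2_Q(\mathfrak l_i,\theta_i,\mathfrak a_i)$ with $\varphi=(q_1,j_1)^*\varphi_1+(q_2,j_2)^*\varphi_2$ (addition of representatives). Otherwise it is *indecomposable*. Let $\mathcal H^2_Q(\mathfrak l,\theta,\mathfrak a)_0$ be the set of admissible indecomposable classes. **Proposition.** Let $(\mathfrak l,\theta)$, with basis $X,Y,Z$, be one of * $\mathfrak r_{3,-1}$: $[X,Y]=Y$, $[X,Z]=-Z$, $[Y,Z]=0$, with $\mathfrak l_+=\mathbb R(Y+Z)$ and $\mathfrak l_-=\mathrm{span}\{X,Y-Z\}$; * $\mathfrak n(2)$: $[X,Y]=Z$, $[X,Z]=-Y$, $[Y,Z]=0$, with $\mathfrak l_+=\mathbb RZ$ and $\mathfrak l_-=\mathrm{span}\{X,Y\}$; and let $\mathfrak a$ be a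 semi-simple orthogonal $(\mathfrak l,\theta)$-module. For $c\in\mathbb C$ let $E_c=\{A\in\mathfrak a_{\mathbb C}\mid \rho(X)A=cA,\ \rho(Y)A=\rho(Z)A=0\}$. Define $$Z_{\mathfrak l}=\{\alpha\in C^2(\mathfrak l,\mathfrak a)\mid \alpha(Y,Z)\in\mathfrak a^{\mathfrak l}_-,\ \alpha(X,Y)\in E_1,\ \theta_{\mathfrak a}(\alpha(X,Y))=-\alpha(X,Z)\}$$ if $\mathfrak l=\mathfrak r_{3,-1}$, and $$Z_{\mathfrak l}=\{\alpha\in C^2(\mathfrak l,\mathfrak a)\mid \alpha(Y,Z)\in\mathfrak a^{\mathfrak l}_-,\ \alpha(X,Y)\in(E_i\oplus E_{-i})\cap\mathfrak a_+,\ \alpha(X,Z)=\rho(X)\alpha(X,Y)\}$$ if $\mathfrak l=\mathfrak n(2)$. Then $(\alpha,0)\in\mathcal Z_+$ for all $\alpha\in Z_{\mathfrak l}$ and $(0,\gamma)\in\mathcal Z_+$ for all $\gamma\in C^3(\mathfrak l)$, and the map from the disjoint union $$(Z_{\mathfrak l}\setminus\{0\})\sqcup C^3(\mathfrak l)\longrightarrow\mathcal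 H^2_Q(\mathfrak l,\theta,\mathfrak a),\qquad \alpha\mapsto[\alpha,0],\quad \gamma\mapsto[0,\gamma]$$ is a bijection. Moreover, for all $\alpha\in Z_{\mathfrak l}\setminus\{0\}$ and all $\gamma\in C^3(\mathfrak l)$, $$[\alpha,0]\in\mathcal H^2_Q(\mathfrak l,\theta,\mathfrak a)_0\iff \mathfrak a^{\mathfrak l}=\mathbb R\cdot\alpha(Y,Z)\ \text{ and }\ \mathrm{span}\{\alpha(X,Y),\alpha(X,Z)\}\text{ is non-degenerate},$$ $$[0,\gamma]\in\mathcal H^2_Q(\mathfrak l,\theta,\mathfrak a)_0\iff \mathfrak a^{\mathfrak l}=0\ \text{ and }\ \gamma\neq0.$$ -/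

import Mathlib

open scoped TensorProduct
open LieModule.Cohomology

universe u v

namespace QuadCoh

/-! ### Lie algebras with involution and orthogonal modules -/

/-- An involutive automorphism `θ` of a real Lie algebra. -/
structure LieInvolution (l : Type u) [LieRing l] [LieAlgebra ℝ l] where
  toHom : l →ₗ⁅ℝ⁆ l
  invol : ∀ x, toHom (toHom x) = x

/-- The data making an `l`-module `a` (with action `⁅L, A⁆ = ρ(L) A`) into an orthogonal
`(l, θ)`-module: a non-degenerate symmetric bilinear form for which `l` acts by skew maps, and an
involutive isometry of `a` compatible with `θ`. -/
structure OrthModule {l : Type u} [LieRing l] [LieAlgebra ℝ l] (θ : LieInvolution l)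
    (a : Type v) [AddCommGroup a] [Module ℝ a] [LieRingModule l a] [LieModule ℝ l a] where
  form : LinearMap.BilinForm ℝ a
  symm : ∀ A B, form A B = form B A
  nondeg : form.Nondegenerate
  skew : ∀ (L : l) (A B : a), form ⁅L, A⁆ B + form A ⁅L, B⁆ = 0
  theta : a →ₗ[ℝ] a
  theta_invol : ∀ A, theta (theta A) = A
  theta_isom : ∀ A B, form (theta A) (theta B) = form A B
  compat : ∀ (L : l) (A : a), theta ⁅θ.toHom L, A⁆ = ⁅L, theta A⁆

section General

variable {l : Type u} [LieRing l] [LieAlgebra ℝ l] {θ : LieInvolution l}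
  {a : Type v} [AddCommGroup a] [Module ℝ a] [LieRingModule l a] [LieModule ℝ l a]

/-! ### Cochains

`C¹(l,a)` is `l →ₗ[ℝ] a`, `C²(l,a)` is Mathlib's `twoCochain ℝ l a` (alternating bilinear maps) with
Mathlib's differentials `d₁₂`, `d₂₃`, and `C²(l)`, `C³(l)` are the alternating forms on `l`. -/

/-- `C³(l)`, the alternating 3-forms on `l`. -/
abbrev ThreeForm (l : Type u) [LieRing l] [LieAlgebra ℝ l] := l [⋀^Fin 3]→ₗ[ℝ] ℝ

/-- The differential `C²(l) → C³(l)` (trivial coefficients), evaluated at `x, y, z`. -/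
def dTwo (σ : twoCochain ℝ l ℝ) (x y z : l) : ℝ :=
  - σ ⁅x, y⁆ z + σ ⁅x, z⁆ y - σ ⁅y, z⁆ x

/-- The differential `C³(l) → C⁴(l)` (trivial coefficients), evaluated at `w, x, y, z`. -/
def dThree (γ : ThreeForm l) (w x y z : l) : ℝ :=
  - γ ![⁅w, x⁆, y, z] + γ ![⁅w, y⁆, x, z] - γ ![⁅w, z⁆, x, y]
    - γ ![⁅x, y⁆, w, z] + γ ![⁅x, z⁆, w, y] - γ ![⁅y, z⁆, w, x]

/-- `⟨τ₁ ∧ τ₂⟩` for `τ₁, τ₂ ∈ C¹(l,a)`. -/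
def wedgeOneOne (M : OrthModule θ a) (τ₁ τ₂ : l →ₗ[ℝ] a) : twoCochain ℝ l ℝ :=
  ⟨M.form.compl₁₂ τ₁ τ₂ - (M.form.compl₁₂ τ₁ τ₂).flip, fun x => by simp⟩

/-- `⟨α ∧ τ⟩` for `α ∈ C²(l,a)`, `τ ∈ C¹(l,a)`, evaluated at `x, y, z`. -/
def wedgeTwoOne (M : OrthModule θ a) (α : twoCochain ℝ l a) (τ : l →ₗ[ℝ] a) (x y z : l) : ℝ :=
  M.form (α x y) (τ z) - M.form (α x z) (τ y) + M.form (α y z) (τ x)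

/-- `⟨α ∧ β⟩` for `α, β ∈ C²(l,a)`, evaluated at `w, x, y, z` (the sum over all `(2,2)`-shuffles). -/
def wedgeTwoTwo (M : OrthModule θ a) (α β : twoCochain ℝ l a) (w x y z : l) : ℝ :=
  M.form (α w x) (β y z) - M.form (α w y) (β x z) + M.form (α w z) (β x y)
    + M.form (α x y) (β w z) - M.form (α x z) (β w y) + M.form (α y z) (β w x)

/-! ### The quadratic cohomology set -/

/-- `(α, γ) ∈ Z²_Q(l,a)₊`: the pair is a quadratic 2-cocycle, i.e. `dα = 0` and
`dγ = ½⟨α ∧ α⟩`, and both entries are invariant under the action of the involutions. -/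
structure IsCocycle (M : OrthModule θ a) (α : twoCochain ℝ l a) (γ : ThreeForm l) : Prop where
  closed : d₂₃ ℝ l a α = 0
  quad : ∀ w x y z, dThree γ w x y z = 1 / 2 * wedgeTwoTwo M α α w x y z
  inv_left : ∀ x y, M.theta (α (θ.toHom x) (θ.toHom y)) = α x y
  inv_right : ∀ x y z, γ ![θ.toHom x, θ.toHom y, θ.toHom z] = γ ![x, y, z]

/-- The set `Z²_Q(l,a)₊`. -/
def Cocycle (M : OrthModule θ a) : Type (max u v) :=
  {p : twoCochain ℝ l a × ThreeForm l // IsCocycle M p.1 p.2}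

/-- `(α', γ') = (α, γ)(τ, σ)` for some `(τ, σ)` in the group
`C¹_Q(l,a)₊ = C¹(l,a)₊ ⊕ C²(l)₊` of invariant quadratic 1-cochains. -/
def Cocycle.Rel (M : OrthModule θ a) (c c' : Cocycle M) : Prop :=
  ∃ (τ : l →ₗ[ℝ] a) (σ : twoCochain ℝ l ℝ),
    (∀ x, M.theta (τ (θ.toHom x)) = τ x) ∧
    (∀ x y, σ (θ.toHom x) (θ.toHom y) = σ x y) ∧
    c'.1.1 = c.1.1 + d₁₂ ℝ l a τ ∧
    ∀ x y z, c'.1.2 ![x, y, z] = c.1.2 ![x, y, z] + dTwo σ x y z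
      + wedgeTwoOne M (c.1.1 + (1 / 2 : ℝ) • d₁₂ ℝ l a τ) τ x y z

theorem skew_left (M : OrthModule θ a) (L : l) (A B : a) :
    M.form ⁅L, A⁆ B = - M.form A ⁅L, B⁆ := by linarith [M.skew L A B]

theorem skew_right (M : OrthModule θ a) (A : a) (L : l) (B : a) :
    M.form A ⁅L, B⁆ = - M.form B ⁅L, A⁆ := by rw [M.symm, skew_left]

theorem wedgeOneOne_apply (M : OrthModule θ a) (τ₁ τ₂ : l →ₗ[ℝ] a) (x y : l) :
    wedgeOneOne M τ₁ τ₂ x y = M.form (τ₁ x) (τ₂ y) - M.form (τ₁ y) (τ₂ x) := rfl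

/-- The orbits of the action of the quadratic 1-cochains, whose group law is
`(τ₁, σ₁) * (τ₂, σ₂) = (τ₁ + τ₂, σ₁ + σ₂ + ½⟨τ₁ ∧ τ₂⟩)`. -/
theorem Cocycle.rel_equivalence (M : OrthModule θ a) : Equivalence (Cocycle.Rel M) where
  refl c := ⟨0, 0, by simp, fun _ _ => rfl, by simp, fun x y z => by
    have h : ∀ x y : l, (0 : twoCochain ℝ l ℝ) x y = 0 := fun _ _ => rfl
    simp [dTwo, wedgeTwoOne, h]⟩
  symm := by
    rintro c c' ⟨τ, σ, hτ, hσ, h1, h2⟩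
    refine ⟨-τ, (-1 : ℝ) • σ, by simpa using hτ, ?_, ?_, ?_⟩
    · intro x y
      rw [smul_apply_apply, smul_apply_apply, hσ]
    · rw [h1]
      apply Subtype.ext
      ext x y
      simp
    · intro x y z
      have hd : ∀ x y : l, d₁₂ ℝ l a (-τ) x y = - d₁₂ ℝ l a τ x y := fun x y => by
        simp only [d₁₂_apply_apply, LinearMap.neg_apply, lie_neg]
        abel
      rw [h2 x y z, h1]
      simp only [dTwo, wedgeTwoOne, add_apply_apply, smul_apply_apply, hd]
      simp only [d₁₂_apply_apply, LinearMap.neg_apply, map_add, map_sub, map_neg, map_smul, LinearMap.add_apply,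
        LinearMap.sub_apply, LinearMap.smul_apply, LinearMap.neg_apply, smul_eq_mul]
      ring
  trans := by
    rintro c c' c'' ⟨τ, σ, hτ, hσ, h1, h2⟩ ⟨τ', σ', hτ', hσ', h1', h2'⟩
    have e : ∀ x y : l, (σ + σ' + (1 / 2 : ℝ) • wedgeOneOne M τ τ') x y
        = σ x y + σ' x y + 1 / 2 * (M.form (τ x) (τ' y) - M.form (τ y) (τ' x)) :=
      fun _ _ => rfl
    refine ⟨τ + τ', σ + σ' + (1 / 2 : ℝ) • wedgeOneOne M τ τ', ?_, ?_, ?_, ?_⟩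
    · intro x
      simp [hτ x, hτ' x]
    · intro x y
      have i : ∀ x y : l, M.form (τ (θ.toHom x)) (τ' (θ.toHom y)) = M.form (τ x) (τ' y) := by
        intro x y
        rw [← M.theta_isom, hτ, hτ']
      rw [e, e, hσ, hσ', i, i]
    · rw [h1', h1, map_add, add_assoc]
    · intro x y z
      rw [h2', h2, h1]
      simp only [dTwo, wedgeTwoOne, e, add_apply_apply, smul_apply_apply, d₁₂_apply_apply,
        map_add, map_sub, map_smul, LinearMap.add_apply,
        LinearMap.sub_apply, LinearMap.smul_apply, smul_eq_mul, skew_left M]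
      rw [M.symm (τ z) (τ' ⁅x, y⁆), M.symm (τ y) (τ' ⁅x, z⁆), M.symm (τ x) (τ' ⁅y, z⁆),
        skew_right M (τ' x) y (τ z), skew_right M (τ' x) z (τ y), skew_right M (τ' y) x (τ z),
        skew_right M (τ' y) z (τ x), skew_right M (τ' z) x (τ y), skew_right M (τ' z) y (τ x)]
      ring

instance cocycleSetoid (M : OrthModule θ a) : Setoid (Cocycle M) :=
  ⟨Cocycle.Rel M, Cocycle.rel_equivalence M⟩

/-- The quadratic cohomology set `H²_Q(l, θ, a)`. -/
def HQ (M : OrthModule θ a) : Type (max u v) := Quotient (cocycleSetoid M)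

/-- The class `[α, γ]`. -/
def HQ.mk (M : OrthModule θ a) (α : twoCochain ℝ l a) (γ : ThreeForm l) (h : IsCocycle M α γ) :
    HQ M :=
  Quotient.mk (cocycleSetoid M) ⟨(α, γ), h⟩

/-! ### Admissible classes -/

/-- For ideals `I ≤ J` of `l`, the `l`-module `J / I` is semi-simple: its submodules correspond to
the ideals between `I` and `J`, and each of them has a complement. -/
def SemisimpleQuotient (I J : LieIdeal ℝ l) : Prop :=
  ∀ K : LieIdeal ℝ l, I ≤ K → K ≤ J →
    ∃ K' : LieIdeal ℝ l, I ≤ K' ∧ K' ≤ J ∧ K ⊓ K' = I ∧ K ⊔ K' = J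

/-- `R₀(l) = l`, and `R_{k+1}(l)` is the smallest ideal contained in `R_k(l)` with semi-simple
quotient `R_k(l) / R_{k+1}(l)`. -/
noncomputable def Rad (l : Type u) [LieRing l] [LieAlgebra ℝ l] : ℕ → LieIdeal ℝ l
  | 0 => ⊤
  | k + 1 => sInf {I | I ≤ Rad l k ∧ SemisimpleQuotient I (Rad l k)}

/-- The socle `S(l) = S₁(l)`: the largest ideal which is semi-simple as an `l`-module. -/
noncomputable def Soc (l : Type u) [LieRing l] [LieAlgebra ℝ l] : LieIdeal ℝ l :=
  sSup {J | SemisimpleQuotient ⊥ J}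

/-- The representation of `l` on `a` is semi-simple. -/
def SemisimpleModule (l : Type u) [LieRing l] [LieAlgebra ℝ l]
    (a : Type v) [AddCommGroup a] [Module ℝ a] [LieRingModule l a] [LieModule ℝ l a] : Prop :=
  ComplementedLattice (LieSubmodule ℝ l a)

/-- The `+1`-eigenspace `l₊`. -/
def LieInvolution.plus (θ : LieInvolution l) : Submodule ℝ l :=
  Module.End.eigenspace (θ.toHom : l →ₗ[ℝ] l) 1

/-- The `-1`-eigenspace `l₋`. -/
def LieInvolution.minus (θ : LieInvolution l) : Submodule ℝ l :=
  Module.End.eigenspace (θ.toHom : l →ₗ[ℝ] l) (-1)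

/-- The `+1`-eigenspace `a₊`. -/
def OrthModule.plus (M : OrthModule θ a) : Submodule ℝ a := Module.End.eigenspace M.theta 1

/-- The `-1`-eigenspace `a₋`. -/
def OrthModule.minus (M : OrthModule θ a) : Submodule ℝ a := Module.End.eigenspace M.theta (-1)

/-- The space `a^l` of invariants. -/
def OrthModule.inv (_M : OrthModule θ a) : Submodule ℝ a :=
  (LieModule.maxTrivSubmodule ℝ l a).toSubmodule

/-- The subspace `ρ(l) a`. -/
def OrthModule.moved (_M : OrthModule θ a) : Submodule ℝ a :=
  (⁅(⊤ : LieIdeal ℝ l), (⊤ : LieSubmodule ℝ l a)⁆).toSubmodule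

/-- A subspace of `a` is non-degenerate if the scalar product restricted to it is. -/
def OrthModule.NondegOn (M : OrthModule θ a) (N : Submodule ℝ a) : Prop :=
  (M.form.restrict N).Nondegenerate

/-- `α(ker [·,·]_V)`, the set of all `∑ᵢ α(xᵢ, yᵢ)` with `xᵢ, yᵢ ∈ V` and `∑ᵢ [xᵢ, yᵢ] = 0`.
(The kernel may be taken in `V ⊗ V` instead of `⋀² V`, since `α` and the bracket are alternating.) -/
noncomputable def kerImage (α : twoCochain ℝ l a) (V : Submodule ℝ l) : Submodule ℝ a :=
  (LinearMap.ker (TensorProduct.lift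
    (((LieModule.toEnd ℝ l l : l →ₗ[ℝ] (l →ₗ[ℝ] l))).domRestrict₁₂ V V))).map
    (TensorProduct.lift (α.1.domRestrict₁₂ V V))

/-- `α₀(ker [·,·]_V)`, where `α₀` is the component of `α` in `a^l` with respect to
`a = a^l ⊕ ρ(l)a`: the image of `α(ker [·,·]_V)` under the projection onto `a^l` along `ρ(l)a`. -/
noncomputable def invKerImage (M : OrthModule θ a) (α : twoCochain ℝ l a) (V : Submodule ℝ l) :
    Submodule ℝ a :=
  (kerImage α V ⊔ M.moved) ⊓ M.inv

/-- `(T₁)`: `[l₋, l₋] = l₊`. -/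
def CondT₁ (θ : LieInvolution l) : Prop :=
  Submodule.span ℝ {w | ∃ x ∈ θ.minus, ∃ y ∈ θ.minus, ⁅x, y⁆ = w} = θ.plus

/-- `(T₂)`: `a^l₊ = α₀(ker [·,·]_{l₋})`. -/
def CondT₂ (M : OrthModule θ a) (α : twoCochain ℝ l a) : Prop :=
  M.inv ⊓ M.plus = invKerImage M α θ.minus

/-- `(A₀)`. -/
def CondA₀ (M : OrthModule θ a) (α : twoCochain ℝ l a) (γ : ThreeForm l) : Prop :=
  ∀ L₀ : l, (∀ L : l, ⁅L, L₀⁆ = 0) → (∀ A : a, ⁅L₀, A⁆ = 0) →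
    (∃ (A₀ : a) (Z₀ : l →ₗ[ℝ] ℝ), ∀ L : l,
      α L L₀ = ⁅L, A₀⁆ ∧ ∀ L' : l, γ ![L, L₀, L'] = - M.form A₀ (α L L') + Z₀ ⁅L, L'⁆) →
    L₀ = 0

/-- `(B₀)`. -/
def CondB₀ (M : OrthModule θ a) (α : twoCochain ℝ l a) : Prop :=
  M.NondegOn (invKerImage M α ⊤)

/-- `(A_k)`, `k ≥ 1`. -/
def CondA (M : OrthModule θ a) (α : twoCochain ℝ l a) (γ : ThreeForm l) (k : ℕ) : Prop :=
  ∀ I : LieIdeal ℝ l, I ≤ Soc l ⊓ Rad l k →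
    (∃ (Φ₁ : I →ₗ[ℝ] a) (Φ₂ : I →ₗ[ℝ] (Rad l k →ₗ[ℝ] ℝ)), ∀ (L : l) (K : I),
      α L K = ⁅L, Φ₁ K⁆ - Φ₁ ⁅L, K⁆ ∧
      ∀ W : Rad l k, γ ![L, K, W] = - M.form (Φ₁ K) (α L W) + Φ₂ K ⁅L, W⁆ + Φ₂ ⁅L, K⁆ W) →
    I = ⊥

/-- `b ⊆ a` is a submodule for which the system of equations in `(B_k)` is solvable. -/
def SolvableOn (M : OrthModule θ a) (α : twoCochain ℝ l a) (k : ℕ) (b : LieSubmodule ℝ l a) :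
    Prop :=
  ∃ Φ : Rad l k →ₗ[ℝ] a, ∀ (L : l) (K : Rad l k), ∀ B ∈ b,
    M.form (α L K) B = M.form (⁅L, Φ K⁆ - Φ ⁅L, K⁆) B

/-- `(B_k)`, `k ≥ 1`. -/
def CondB (M : OrthModule θ a) (α : twoCochain ℝ l a) (k : ℕ) : Prop :=
  ∃ b : LieSubmodule ℝ l a, IsGreatest {b' | SolvableOn M α k b'} b ∧ M.NondegOn b.toSubmodule

/-- Admissible cohomology classes. The properties `(T₁)` of `(l, θ)` and semi-simplicity of `a` are
standing assumptions of the notion. Conditions `(A_k)`, `(B_k)` hold trivially once `R_k(l) = 0`. -/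
def IsAdmissible (M : OrthModule θ a) (φ : HQ M) : Prop :=
  CondT₁ θ ∧ SemisimpleModule l a ∧
    ∃ (α : twoCochain ℝ l a) (γ : ThreeForm l) (h : IsCocycle M α γ), φ = HQ.mk M α γ h ∧
      CondT₂ M α ∧ CondA₀ M α γ ∧ CondB₀ M α ∧ ∀ k, 1 ≤ k → CondA M α γ k ∧ CondB M α k

/-! ### Decompositions -/

/-- A morphism of triples `(S, U) : (l, θ, a) → (l', θ', a')`; note that `U : a' → a`. -/
structure TripleHom (M : OrthModule θ a)
    {l' : Type u} [LieRing l'] [LieAlgebra ℝ l'] {θ' : LieInvolution l'}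
    {a' : Type v} [AddCommGroup a'] [Module ℝ a'] [LieRingModule l' a'] [LieModule ℝ l' a']
    (M' : OrthModule θ' a') where
  S : l →ₗ⁅ℝ⁆ l'
  U : a' →ₗ[ℝ] a
  isom : ∀ A B, M.form (U A) (U B) = M'.form A B
  equivariant : ∀ (L : l) (A : a'), U ⁅S L, A⁆ = ⁅L, U A⁆
  S_theta : ∀ x, S (θ.toHom x) = θ'.toHom (S x)
  U_theta : ∀ A, U (M'.theta A) = M.theta (U A)

/-- `(q₁, j₁)` and `(q₂, j₂)` form a non-trivial decomposition of `(l, θ, a)`: both are non-zero and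
`(q₁, j₁) ⊕ (q₂, j₂)` is an isomorphism onto the direct sum of the two triples, i.e.
`(q₁, q₂) : l → l₁ ⊕ l₂` is bijective and `j₁ + j₂ : a₁ ⊕ a₂ → a` is an isometric bijection from the
orthogonal direct sum. -/
structure IsNontrivialDecomposition {M : OrthModule θ a}
    {l₁ : Type u} [LieRing l₁] [LieAlgebra ℝ l₁] {θ₁ : LieInvolution l₁}
    {a₁ : Type v} [AddCommGroup a₁] [Module ℝ a₁] [LieRingModule l₁ a₁] [LieModule ℝ l₁ a₁]
    {M₁ : OrthModule θ₁ a₁}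
    {l₂ : Type u} [LieRing l₂] [LieAlgebra ℝ l₂] {θ₂ : LieInvolution l₂}
    {a₂ : Type v} [AddCommGroup a₂] [Module ℝ a₂] [LieRingModule l₂ a₂] [LieModule ℝ l₂ a₂]
    {M₂ : OrthModule θ₂ a₂}
    (f₁ : TripleHom M M₁) (f₂ : TripleHom M M₂) : Prop where
  ne_zero₁ : ¬ (f₁.S = 0 ∧ f₁.U = 0)
  ne_zero₂ : ¬ (f₂.S = 0 ∧ f₂.U = 0)
  bijective_l : Function.Bijective (fun x : l => (f₁.S x, f₂.S x))
  bijective_a : Function.Bijective (fun p : a₁ × a₂ => f₁.U p.1 + f₂.U p.2)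
  orthogonal : ∀ A B, M.form (f₁.U A) (f₂.U B) = 0

/-- A class is decomposable if, for some non-trivial decomposition, it is the sum
`(q₁, j₁)^* φ₁ + (q₂, j₂)^* φ₂`, the sum being formed on representing cocycles; the pull-back of
`(α, γ)` under `(q, j)` is `(j ∘ α(q ·, q ·), γ(q ·, q ·, q ·))`. -/
def IsDecomposable (M : OrthModule θ a) (φ : HQ M) : Prop :=
  ∃ (l₁ : Type u) (_ : LieRing l₁) (_ : LieAlgebra ℝ l₁) (_ : FiniteDimensional ℝ l₁)
    (θ₁ : LieInvolution l₁)
    (a₁ : Type v) (_ : AddCommGroup a₁) (_ : Module ℝ a₁) (_ : FiniteDimensional ℝ a₁)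
    (_ : LieRingModule l₁ a₁) (_ : LieModule ℝ l₁ a₁) (M₁ : OrthModule θ₁ a₁)
    (l₂ : Type u) (_ : LieRing l₂) (_ : LieAlgebra ℝ l₂) (_ : FiniteDimensional ℝ l₂)
    (θ₂ : LieInvolution l₂)
    (a₂ : Type v) (_ : AddCommGroup a₂) (_ : Module ℝ a₂) (_ : FiniteDimensional ℝ a₂)
    (_ : LieRingModule l₂ a₂) (_ : LieModule ℝ l₂ a₂) (M₂ : OrthModule θ₂ a₂)
    (f₁ : TripleHom M M₁) (f₂ : TripleHom M M₂),
    IsNontrivialDecomposition f₁ f₂ ∧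
    ∃ (c : Cocycle M) (c₁ : Cocycle M₁) (c₂ : Cocycle M₂),
      φ = Quotient.mk (cocycleSetoid M) c ∧
      (∀ x y, c.1.1 x y
        = f₁.U (c₁.1.1 (f₁.S x) (f₁.S y)) + f₂.U (c₂.1.1 (f₂.S x) (f₂.S y))) ∧
      ∀ x y z, c.1.2 ![x, y, z]
        = c₁.1.2 ![f₁.S x, f₁.S y, f₁.S z] + c₂.1.2 ![f₂.S x, f₂.S y, f₂.S z]

/-- `H²_Q(l, θ, a)₀`, the set of admissible indecomposable classes. -/
def HQ₀ (M : OrthModule θ a) : Set (HQ M) := {φ | IsAdmissible M φ ∧ ¬ IsDecomposable M φ}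

/-- The space `{A ∈ a_ℂ | ρ(L)A = χ(L)A for all L ∈ l}` in the complexification `a_ℂ = ℂ ⊗ a`. -/
noncomputable def weightSpace (a : Type v) [AddCommGroup a] [Module ℝ a] [LieRingModule l a]
    [LieModule ℝ l a] (χ : l →ₗ[ℝ] ℂ) : Submodule ℂ (ℂ ⊗[ℝ] a) where
  carrier := {A | ∀ L : l, (LieModule.toEnd ℝ l a L).baseChange ℂ A = χ L • A}
  add_mem' hA hB L := by rw [map_add, hA L, hB L, smul_add]
  zero_mem' L := by simp
  smul_mem' c A hA L := by rw [map_smul, hA L, smul_comm]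

end General

/-! ### The Lie algebra `𝔯_{3,-1}` -/

/-- `𝔯_{3,-1}`, with basis `X, Y, Z` and brackets `[X,Y] = Y`, `[X,Z] = -Z`, `[Y,Z] = 0`. -/
def R31 : Type := Fin 3 → ℝ

namespace R31

instance : AddCommGroup R31 := inferInstanceAs (AddCommGroup (Fin 3 → ℝ))
instance : Module ℝ R31 := inferInstanceAs (Module ℝ (Fin 3 → ℝ))
instance : FiniteDimensional ℝ R31 := inferInstanceAs (FiniteDimensional ℝ (Fin 3 → ℝ))

/-- The element with coordinates `r, s, t`. -/
def vec (r s t : ℝ) : R31 := ![r, s, t]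

@[simp] theorem vec_zero (r s t : ℝ) : vec r s t 0 = r := rfl
@[simp] theorem vec_one (r s t : ℝ) : vec r s t 1 = s := rfl
@[simp] theorem vec_two (r s t : ℝ) : vec r s t 2 = t := rfl

def X : R31 := vec 1 0 0
def Y : R31 := vec 0 1 0
def Z : R31 := vec 0 0 1

instance : Bracket R31 R31 where
  bracket s t := vec 0 (s 0 * t 1 - s 1 * t 0) (-(s 0 * t 2 - s 2 * t 0))

@[simp] theorem bracket_zero (s t : R31) : ⁅s, t⁆ 0 = 0 := rfl
@[simp] theorem bracket_one (s t : R31) : ⁅s, t⁆ 1 = s 0 * t 1 - s 1 * t 0 := rfl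
@[simp] theorem bracket_two (s t : R31) : ⁅s, t⁆ 2 = -(s 0 * t 2 - s 2 * t 0) := rfl
@[simp] theorem add_apply (s t : R31) (i : Fin 3) : (s + t) i = s i + t i := rfl
@[simp] theorem smul_apply (r : ℝ) (s : R31) (i : Fin 3) : (r • s) i = r * s i := rfl
@[simp] theorem zero_apply (i : Fin 3) : (0 : R31) i = 0 := rfl

theorem ext3 {s t : R31} (h0 : s 0 = t 0) (h1 : s 1 = t 1) (h2 : s 2 = t 2) : s = t := by
  funext i
  fin_cases i <;> assumption

instance : LieRing R31 where
  add_lie s t w := by apply ext3 <;> simp <;> ring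
  lie_add s t w := by apply ext3 <;> simp <;> ring
  lie_self s := by apply ext3 <;> simp <;> ring
  leibniz_lie s t w := by apply ext3 <;> simp <;> ring

instance : LieAlgebra ℝ R31 where
  lie_smul r s t := by apply ext3 <;> simp <;> ring

/-- The involution with `l₊ = ℝ(Y+Z)` and `l₋ = span {X, Y-Z}`. -/
def theta : LieInvolution R31 where
  toHom :=
    { toFun := fun s => vec (-s 0) (s 2) (s 1)
      map_add' := fun s t => by apply ext3 <;> simp; ring
      map_smul' := fun r s => by apply ext3 <;> simp
      map_lie' := fun {s t} => by apply ext3 <;> simp <;> ring }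
  invol s := by apply ext3 <;> simp

/-- The linear form `χ` on `l / l'` with `χ(X) = c`. -/
noncomputable def weight (c : ℂ) : R31 →ₗ[ℝ] ℂ where
  toFun s := (s 0 : ℂ) * c
  map_add' s t := by simp; ring
  map_smul' r s := by simp; ring

/-- The weight space `E_c ⊆ a_ℂ`. -/
noncomputable def E (a : Type v) [AddCommGroup a] [Module ℝ a] [LieRingModule R31 a]
    [LieModule ℝ R31 a] (c : ℂ) : Submodule ℂ (ℂ ⊗[ℝ] a) := weightSpace a (weight c)

/-- The space of all `α ∈ C²(l,a)` with `α(Y,Z) ∈ a^l₋`, `α(X,Y) ∈ E_1` and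
`θ_a(α(X,Y)) = -α(X,Z)`. -/
noncomputable def ZSpace {a : Type v} [AddCommGroup a] [Module ℝ a] [LieRingModule R31 a]
    [LieModule ℝ R31 a] (M : OrthModule theta a) : Submodule ℝ (twoCochain ℝ R31 a) where
  carrier := {α | α Y Z ∈ M.inv ⊓ M.minus ∧ (1 : ℂ) ⊗ₜ[ℝ] (α X Y) ∈ E a 1 ∧
    M.theta (α X Y) = - α X Z}
  add_mem' {α β} hα hβ := by
    refine ⟨Submodule.add_mem _ hα.1 hβ.1, ?_, ?_⟩
    · rw [add_apply_apply, TensorProduct.tmul_add]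
      exact Submodule.add_mem _ hα.2.1 hβ.2.1
    · rw [add_apply_apply, add_apply_apply, map_add, hα.2.2, hβ.2.2, neg_add]
  zero_mem' := by
    have h : ∀ s t : R31, (0 : twoCochain ℝ R31 a) s t = 0 := fun _ _ => rfl
    refine ⟨by rw [h]; exact Submodule.zero_mem _, ?_, by simp [h]⟩
    rw [h, TensorProduct.tmul_zero]
    exact Submodule.zero_mem _
  smul_mem' r α hα := by
    refine ⟨Submodule.smul_mem _ r hα.1, ?_, ?_⟩
    · have h : (1 : ℂ) ⊗ₜ[ℝ] ((r • α) X Y) = (r : ℂ) • ((1 : ℂ) ⊗ₜ[ℝ] (α X Y)) := by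
        rw [smul_apply_apply, ← TensorProduct.smul_tmul, TensorProduct.smul_tmul',
          Complex.real_smul, smul_eq_mul]
      rw [h]
      exact Submodule.smul_mem _ _ hα.2.1
    · rw [smul_apply_apply, smul_apply_apply, map_smul, hα.2.2, smul_neg]

end R31

/-! ### The Lie algebra `𝔫(2)` -/

/-- `𝔫(2)`, with basis `X, Y, Z` and brackets `[X,Y] = Z`, `[X,Z] = -Y`, `[Y,Z] = 0`. -/
def N2 : Type := Fin 3 → ℝ

namespace N2

instance : AddCommGroup N2 := inferInstanceAs (AddCommGroup (Fin 3 → ℝ))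
instance : Module ℝ N2 := inferInstanceAs (Module ℝ (Fin 3 → ℝ))
instance : FiniteDimensional ℝ N2 := inferInstanceAs (FiniteDimensional ℝ (Fin 3 → ℝ))

/-- The element with coordinates `r, s, t`. -/
def vec (r s t : ℝ) : N2 := ![r, s, t]

@[simp] theorem vec_zero (r s t : ℝ) : vec r s t 0 = r := rfl
@[simp] theorem vec_one (r s t : ℝ) : vec r s t 1 = s := rfl
@[simp] theorem vec_two (r s t : ℝ) : vec r s t 2 = t := rfl

def X : N2 := vec 1 0 0
def Y : N2 := vec 0 1 0
def Z : N2 := vec 0 0 1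

instance : Bracket N2 N2 where
  bracket s t := vec 0 (-(s 0 * t 2 - s 2 * t 0)) (s 0 * t 1 - s 1 * t 0)

@[simp] theorem bracket_zero (s t : N2) : ⁅s, t⁆ 0 = 0 := rfl
@[simp] theorem bracket_one (s t : N2) : ⁅s, t⁆ 1 = -(s 0 * t 2 - s 2 * t 0) := rfl
@[simp] theorem bracket_two (s t : N2) : ⁅s, t⁆ 2 = s 0 * t 1 - s 1 * t 0 := rfl
@[simp] theorem add_apply (s t : N2) (i : Fin 3) : (s + t) i = s i + t i := rfl
@[simp] theorem smul_apply (r : ℝ) (s : N2) (i : Fin 3) : (r • s) i = r * s i := rfl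
@[simp] theorem zero_apply (i : Fin 3) : (0 : N2) i = 0 := rfl

theorem ext3 {s t : N2} (h0 : s 0 = t 0) (h1 : s 1 = t 1) (h2 : s 2 = t 2) : s = t := by
  funext i
  fin_cases i <;> assumption

instance : LieRing N2 where
  add_lie s t w := by apply ext3 <;> simp <;> ring
  lie_add s t w := by apply ext3 <;> simp <;> ring
  lie_self s := by apply ext3 <;> simp <;> ring
  leibniz_lie s t w := by apply ext3 <;> simp <;> ring

instance : LieAlgebra ℝ N2 where
  lie_smul r s t := by apply ext3 <;> simp <;> ring

/-- The involution with `l₊ = ℝZ` and `l₋ = span {X, Y}`. -/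
def theta : LieInvolution N2 where
  toHom :=
    { toFun := fun s => vec (-s 0) (-s 1) (s 2)
      map_add' := fun s t => by apply ext3 <;> simp; all_goals ring
      map_smul' := fun r s => by apply ext3 <;> simp
      map_lie' := fun {s t} => by apply ext3 <;> simp <;> ring }
  invol s := by apply ext3 <;> simp

/-- The linear form `χ` on `l / l'` with `χ(X) = c`. -/
noncomputable def weight (c : ℂ) : N2 →ₗ[ℝ] ℂ where
  toFun s := (s 0 : ℂ) * c
  map_add' s t := by simp; ring
  map_smul' r s := by simp; ring

/-- The subspace `E = E_i ⊕ E_{-i}` of `a_ℂ`, where `E_c` is the weight space of the weight with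
value `c` at `X`. -/
noncomputable def E (a : Type v) [AddCommGroup a] [Module ℝ a] [LieRingModule N2 a]
    [LieModule ℝ N2 a] : Submodule ℂ (ℂ ⊗[ℝ] a) :=
  weightSpace a (weight Complex.I) ⊔ weightSpace a (weight (-Complex.I))

/-- The space of all `α ∈ C²(l,a)` with `α(Y,Z) ∈ a^l₋`, `α(X,Y) ∈ E ∩ a₊` and
`α(X,Z) = ρ(X)α(X,Y)`. -/
noncomputable def ZSpace {a : Type v} [AddCommGroup a] [Module ℝ a] [LieRingModule N2 a]
    [LieModule ℝ N2 a] (M : OrthModule theta a) : Submodule ℝ (twoCochain ℝ N2 a) where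
  carrier := {α | α Y Z ∈ M.inv ⊓ M.minus ∧ (1 : ℂ) ⊗ₜ[ℝ] (α X Y) ∈ E a ∧ α X Y ∈ M.plus ∧
    α X Z = ⁅X, α X Y⁆}
  add_mem' {α β} hα hβ := by
    refine ⟨Submodule.add_mem _ hα.1 hβ.1, ?_, Submodule.add_mem _ hα.2.2.1 hβ.2.2.1, ?_⟩
    · rw [add_apply_apply, TensorProduct.tmul_add]
      exact Submodule.add_mem _ hα.2.1 hβ.2.1
    · rw [add_apply_apply, add_apply_apply, lie_add, hα.2.2.2, hβ.2.2.2]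
  zero_mem' := by
    have h : ∀ s t : N2, (0 : twoCochain ℝ N2 a) s t = 0 := fun _ _ => rfl
    refine ⟨by rw [h]; exact Submodule.zero_mem _, ?_, by rw [h]; exact Submodule.zero_mem _,
      by simp [h]⟩
    rw [h, TensorProduct.tmul_zero]
    exact Submodule.zero_mem _
  smul_mem' r α hα := by
    refine ⟨Submodule.smul_mem _ r hα.1, ?_, Submodule.smul_mem _ r hα.2.2.1, ?_⟩
    · have h : (1 : ℂ) ⊗ₜ[ℝ] ((r • α) X Y) = (r : ℂ) • ((1 : ℂ) ⊗ₜ[ℝ] (α X Y)) := by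
        rw [smul_apply_apply, ← TensorProduct.smul_tmul, TensorProduct.smul_tmul',
          Complex.real_smul, smul_eq_mul]
      rw [h]
      exact Submodule.smul_mem _ _ hα.2.1
    · rw [smul_apply_apply, smul_apply_apply, lie_smul, hα.2.2.2]

end N2

end QuadCoh

open QuadCoh

namespace QuadCoh

section General

variable {l : Type u} [LieRing l] [LieAlgebra ℝ l] {θ : LieInvolution l}
  {a : Type v} [AddCommGroup a] [Module ℝ a] [LieRingModule l a] [LieModule ℝ l a]

/-! ### Orthogonal modules -/

namespace OrthModule

variable (M : OrthModule θ a)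

/-! Both algebras have a basis X, P, Q with [X,P] = Q, [X,Q] = εP, [P,Q] = 0, on which θ is -1, -1,
+1; here ε = 1 for 𝔯_{3,-1} and ε = -1 for 𝔫(2). Only ε ≠ 0 matters, so everything is proved once
for such a `Frame`.

Cohomology. P and Q act nilpotently on finite-dimensional modules, hence by zero on semi-simple ones
(`lie_P_eq_zero_and_lie_Q_eq_zero`), and the module is governed by the single skew operator D =
ρ(X). There are no 4-forms in dimension three and ad is traceless, so γ is unconstrained and dσ = 0;
closedness of α only says that α(P,Q) is invariant. A 1-cochain with values y, z at P, Q changes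
(α(X,P), α(X,Q)) by (Dy - z, Dz - εy). What survives of this pair is α(X,Q) + Dα(X,P) modulo the
image of f = D² - ε. Since the module is ker f ⊕ im f, each class has exactly one representative α
with fα(X,P) = 0 and α(X,Q) = Dα(X,P) (`IsHarmonic`), and these α form Z_𝔩. If α ≠ 0, closed τ shift
γ by ⟨α ∧ τ⟩, which takes every value (`exists_wedgeTwoOne_eq`), so γ can be made 0; if α = 0,
closed τ do not move γ.

Admissibility. The centre is zero, R₁ = span{P,Q}, R₂ = 0, and the bracket is injective on ⋀²𝔩₋.
Hence (T₂) says 𝔞^𝔩₊ = 0, (A₀) is vacuous, (A₁) excludes only [0,0], and 𝔟₁ is the orthogonal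
complement of the values of the harmonic α (`isGreatest_orth`). As 𝔩 is not a direct sum, a
decomposition splits off a trivial module orthogonal to a representative. Given 𝔞^𝔩₊ = 0 and 𝔟₁
non-degenerate, indecomposability therefore means that α(P,Q) spans 𝔞^𝔩, and the rest of (B₁) is
non-degeneracy of span{α(X,P), α(X,Q)}. -/

theorem mem_inv {A : a} : A ∈ M.inv ↔ ∀ L : l, ⁅L, A⁆ = 0 := Iff.rfl

theorem mem_plus {A : a} : A ∈ M.plus ↔ M.theta A = A := by
  simp [OrthModule.plus]

theorem mem_minus {A : a} : A ∈ M.minus ↔ M.theta A = -A := by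
  simp [OrthModule.minus]

theorem eq_zero_of_form_left {A : a} (h : ∀ B, M.form A B = 0) : A = 0 := M.nondeg.1 A h

theorem form_isRefl : M.form.IsRefl := fun A B h => by rw [M.symm]; exact h

theorem nondegOn_iff {N : Submodule ℝ a} :
    M.NondegOn N ↔ ∀ A ∈ N, (∀ B ∈ N, M.form A B = 0) → A = 0 := by
  constructor
  · intro h A hA hAB
    have := h.1 ⟨A, hA⟩ (fun B => hAB B.1 B.2)
    simpa using this
  · intro h
    refine ⟨fun A hA => Subtype.ext (h A.1 A.2 fun B hB => hA ⟨B, hB⟩), fun A hA =>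
      Subtype.ext (h A.1 A.2 fun B hB => ?_)⟩
    rw [M.symm]
    exact hA ⟨B, hB⟩

theorem theta_mem_inv {A : a} (hA : A ∈ M.inv) : M.theta A ∈ M.inv := fun L => by
  rw [← M.compat, hA, map_zero]

theorem form_theta_left (A B : a) : M.form (M.theta A) B = M.form A (M.theta B) := by
  rw [← M.theta_isom, M.theta_invol]

theorem form_eq_zero_of_mem_inv_of_mem_moved {A B : a} (hA : A ∈ M.inv) (hB : B ∈ M.moved) :
    M.form A B = 0 := by
  have h : M.moved ≤ LinearMap.ker (M.form A) := by
    rw [OrthModule.moved, LieSubmodule.lieIdeal_oper_eq_linear_span', Submodule.span_le]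
    rintro _ ⟨L, -, C, -, rfl⟩
    show M.form A ⁅L, C⁆ = 0
    rw [skew_right, hA L, map_zero, neg_zero]
  exact h hB

theorem lie_mem_moved (L : l) (A : a) : ⁅L, A⁆ ∈ M.moved :=
  LieSubmodule.lie_mem_lie (LieSubmodule.mem_top L) (LieSubmodule.mem_top A)

end OrthModule

theorem SemisimpleModule.exists_complement (hs : SemisimpleModule l a) (b : LieSubmodule ℝ l a) :
    ∃ c : LieSubmodule ℝ l a, (∀ A, ∃ B ∈ b, ∃ C ∈ c, B + C = A) ∧ ∀ A ∈ b, A ∈ c → A = 0 := by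
  obtain ⟨c, hc⟩ := hs.exists_isCompl b
  refine ⟨c, fun A => ?_, fun A hb hc' => ?_⟩
  · have : A ∈ b ⊔ c := by rw [hc.sup_eq_top]; trivial
    exact (LieSubmodule.mem_sup b c A).1 this
  · have : A ∈ b ⊓ c := ⟨hb, hc'⟩
    rwa [hc.inf_eq_bot, LieSubmodule.mem_bot] at this

namespace OrthModule

variable (M : OrthModule θ a)

/-- If c is a complementary submodule of the invariants, then ρ(l)a = ρ(l)c lies in c. -/
theorem eq_zero_of_mem_inv_of_mem_moved (hs : SemisimpleModule l a) {A : a}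
    (hA : A ∈ M.inv) (hA' : A ∈ M.moved) : A = 0 := by
  obtain ⟨c, hc, hd⟩ := hs.exists_complement (LieModule.maxTrivSubmodule ℝ l a)
  refine hd A hA ?_
  have h : M.moved ≤ c.toSubmodule := by
    rw [OrthModule.moved, LieSubmodule.lieIdeal_oper_eq_linear_span', Submodule.span_le]
    rintro _ ⟨L, -, C, -, rfl⟩
    obtain ⟨B, hB, D, hD, rfl⟩ := hc C
    have hB' : ⁅L, B⁆ = 0 := hB L
    rw [lie_add, hB', zero_add]
    exact c.lie_mem hD
  exact h hA'

/-- A complement c of ρ(l)a is trivial, because ρ(l)c lies in both c and ρ(l)a. -/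
theorem exists_add_of_mem_inv_mem_moved (hs : SemisimpleModule l a) (A : a) :
    ∃ B ∈ M.inv, ∃ C ∈ M.moved, B + C = A := by
  obtain ⟨c, hc, hd⟩ := hs.exists_complement ⁅(⊤ : LieIdeal ℝ l), (⊤ : LieSubmodule ℝ l a)⁆
  obtain ⟨C, hC, B, hB, rfl⟩ := hc A
  exact ⟨B, fun L => hd _ (M.lie_mem_moved L B) (c.lie_mem hB), C, hC, add_comm _ _⟩

theorem nondegOn_inv (hs : SemisimpleModule l a) : M.NondegOn M.inv := by
  rw [nondegOn_iff]
  intro A hA h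
  refine M.eq_zero_of_form_left fun D => ?_
  obtain ⟨B, hB, C, hC, rfl⟩ := M.exists_add_of_mem_inv_mem_moved hs D
  rw [map_add, h B hB, M.form_eq_zero_of_mem_inv_of_mem_moved hA hC, add_zero]

end OrthModule

/-! ### A normal form for the Lie algebras -/

variable (θ) in
/-- A basis `X, P, Q` of `l` with `[X,P] = Q`, `[X,Q] = εP`, `[P,Q] = 0`, `ε ≠ 0`, such that
`X, P ∈ l₋` and `Q ∈ l₊`. -/
structure Frame where
  ε : ℝ
  ε_ne : ε ≠ 0
  b : Module.Basis (Fin 3) ℝ l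
  lie_XP : ⁅b 0, b 1⁆ = b 2
  lie_XQ : ⁅b 0, b 2⁆ = ε • b 1
  lie_PQ : ⁅b 1, b 2⁆ = 0
  theta_X : θ.toHom (b 0) = -b 0
  theta_P : θ.toHom (b 1) = -b 1
  theta_Q : θ.toHom (b 2) = b 2

namespace Frame

variable (F : Frame θ)

/-- The basis vector `X`. -/
noncomputable abbrev X : l := F.b 0

/-- The basis vector `P`. -/
noncomputable abbrev P : l := F.b 1

/-- The basis vector `Q`. -/
noncomputable abbrev Q : l := F.b 2

theorem eq_sum (L : l) :
    L = F.b.coord 0 L • F.X + F.b.coord 1 L • F.P + F.b.coord 2 L • F.Q := by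
  have h := F.b.sum_repr L
  rw [Fin.sum_univ_three] at h
  exact h.symm

theorem lie_PX : ⁅F.P, F.X⁆ = -F.Q := by rw [← lie_skew, F.lie_XP]
theorem lie_QX : ⁅F.Q, F.X⁆ = -(F.ε • F.P) := by rw [← lie_skew, F.lie_XQ]
theorem lie_QP : ⁅F.Q, F.P⁆ = 0 := by rw [← lie_skew, F.lie_PQ, neg_zero]

theorem coord_X : F.b.coord 0 F.X = 1 ∧ F.b.coord 1 F.X = 0 ∧ F.b.coord 2 F.X = 0 := by
  simp [Module.Basis.coord_apply]

theorem coord_P : F.b.coord 0 F.P = 0 ∧ F.b.coord 1 F.P = 1 ∧ F.b.coord 2 F.P = 0 := by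
  simp [Module.Basis.coord_apply]

theorem coord_Q : F.b.coord 0 F.Q = 0 ∧ F.b.coord 1 F.Q = 0 ∧ F.b.coord 2 F.Q = 1 := by
  simp [Module.Basis.coord_apply]

theorem lie_eq (L K : l) : ⁅L, K⁆ =
    (F.ε * (F.b.coord 0 L * F.b.coord 2 K - F.b.coord 2 L * F.b.coord 0 K)) • F.P +
    (F.b.coord 0 L * F.b.coord 1 K - F.b.coord 1 L * F.b.coord 0 K) • F.Q := by
  conv_lhs => rw [F.eq_sum L, F.eq_sum K]
  simp only [add_lie, lie_add, smul_lie, lie_smul, lie_self, F.lie_XP, F.lie_XQ, F.lie_PQ,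
    F.lie_PX, F.lie_QX, F.lie_QP]
  module

theorem coord_zero_lie (L K : l) : F.b.coord 0 ⁅L, K⁆ = 0 := by
  rw [F.lie_eq]
  simp only [map_add, map_smul, F.coord_P.1, F.coord_Q.1, smul_zero, add_zero]

theorem coord_one_lie (L K : l) : F.b.coord 1 ⁅L, K⁆ =
    F.ε * (F.b.coord 0 L * F.b.coord 2 K - F.b.coord 2 L * F.b.coord 0 K) := by
  rw [F.lie_eq]
  simp only [map_add, map_smul, F.coord_P.2.1, F.coord_Q.2.1, smul_eq_mul]
  ring

theorem coord_two_lie (L K : l) : F.b.coord 2 ⁅L, K⁆ =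
    F.b.coord 0 L * F.b.coord 1 K - F.b.coord 1 L * F.b.coord 0 K := by
  rw [F.lie_eq]
  simp only [map_add, map_smul, F.coord_P.2.2, F.coord_Q.2.2, smul_eq_mul]
  ring

theorem theta_eq (L : l) : θ.toHom L =
    (-F.b.coord 0 L) • F.X + (-F.b.coord 1 L) • F.P + F.b.coord 2 L • F.Q := by
  conv_lhs => rw [F.eq_sum L]
  simp only [map_add, map_smul, F.theta_X, F.theta_P, F.theta_Q]
  module

theorem ext_coord {L K : l} (h0 : F.b.coord 0 L = F.b.coord 0 K)
    (h1 : F.b.coord 1 L = F.b.coord 1 K) (h2 : F.b.coord 2 L = F.b.coord 2 K) : L = K := by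
  rw [F.eq_sum L, F.eq_sum K, h0, h1, h2]

theorem coord_theta (L : l) : F.b.coord 0 (θ.toHom L) = -F.b.coord 0 L ∧
    F.b.coord 1 (θ.toHom L) = -F.b.coord 1 L ∧ F.b.coord 2 (θ.toHom L) = F.b.coord 2 L := by
  rw [F.theta_eq]
  simp [Module.Basis.coord_apply]

theorem mem_minus {L : l} : L ∈ θ.minus ↔ F.b.coord 2 L = 0 := by
  rw [LieInvolution.minus, Module.End.mem_eigenspace_iff]
  show θ.toHom L = (-1 : ℝ) • L ↔ _
  constructor
  · intro h
    have h2 := (F.coord_theta L).2.2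
    rw [h, map_smul, smul_eq_mul] at h2
    linarith
  · intro h
    apply F.ext_coord <;> simp only [F.coord_theta, map_smul, smul_eq_mul]
    · ring
    · ring
    · rw [h]; ring

theorem mem_plus {L : l} : L ∈ θ.plus ↔ F.b.coord 0 L = 0 ∧ F.b.coord 1 L = 0 := by
  rw [LieInvolution.plus, Module.End.mem_eigenspace_iff]
  show θ.toHom L = (1 : ℝ) • L ↔ _
  rw [one_smul]
  constructor
  · intro h
    have h0 := (F.coord_theta L).1
    have h1 := (F.coord_theta L).2.1
    rw [h] at h0 h1
    exact ⟨by linarith, by linarith⟩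
  · rintro ⟨h0, h1⟩
    apply F.ext_coord <;> simp [F.coord_theta, h0, h1]

theorem condT₁ (F : Frame θ) : CondT₁ θ := by
  apply le_antisymm
  · rw [Submodule.span_le]
    rintro _ ⟨x, hx, y, hy, rfl⟩
    rw [SetLike.mem_coe, F.mem_plus, F.coord_zero_lie, F.coord_one_lie, F.mem_minus.1 hx,
      F.mem_minus.1 hy]
    simp
  · intro L hL
    rw [F.mem_plus] at hL
    rw [F.eq_sum L, hL.1, hL.2, zero_smul, zero_smul, zero_add, zero_add]
    refine Submodule.smul_mem _ _ (Submodule.subset_span ⟨F.X, ?_, F.P, ?_, F.lie_XP⟩)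
    · exact F.mem_minus.2 F.coord_X.2.2
    · exact F.mem_minus.2 F.coord_P.2.2

end Frame

end General

/-! ### Triviality of the action of the derived algebra -/

/-- The commutator with x is a derivation sending p to q. The extra factor p on the right avoids the
exponent j - 1. -/
theorem mul_pow_sub_pow_mul {a : Type v} [AddCommGroup a] [Module ℝ a] {x p q : Module.End ℝ a}
    (hp : x * p - p * x = q) (hpq : p * q = q * p) (j : ℕ) :
    (x * p ^ j - p ^ j * x) * p = (j : ℝ) • (q * p ^ j) := by
  induction j with
  | zero => simp
  | succ j ih =>
    have h : x * p ^ (j + 1) - p ^ (j + 1) * x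
        = (x * p ^ j - p ^ j * x) * p + p ^ j * (x * p - p * x) := by
      rw [pow_succ]; noncomm_ring
    have h' : p ^ j * q = q * p ^ j := ((show Commute p q from hpq).pow_left j).eq
    rw [h, ih, hp, h', pow_succ, add_mul, smul_mul_assoc, mul_assoc, Nat.cast_add, Nat.cast_one,
      add_smul, one_smul]

theorem mul_aeval_sub_aeval_mul {a : Type v} [AddCommGroup a] [Module ℝ a]
    {x p q : Module.End ℝ a} {ε : ℝ} (hq : x * q - q * x = ε • p) (hpq : p * q = q * p)
    (f : Polynomial ℝ) :
    x * Polynomial.aeval q f - Polynomial.aeval q f * x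
      = ε • (Polynomial.aeval q (Polynomial.derivative f) * p) := by
  have hpow : ∀ n : ℕ, x * q ^ (n + 1) - q ^ (n + 1) * x = ((n + 1 : ℝ) * ε) • (q ^ n * p) := by
    intro n
    induction n with
    | zero => simp [hq]
    | succ n ih =>
      have h : x * q ^ (n + 1 + 1) - q ^ (n + 1 + 1) * x
          = (x * q ^ (n + 1) - q ^ (n + 1) * x) * q + q ^ (n + 1) * (x * q - q * x) := by
        rw [pow_succ q (n + 1)]; noncomm_ring
      rw [h, ih, hq, smul_mul_assoc, mul_assoc, hpq, ← mul_assoc, ← pow_succ, mul_smul_comm,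
        ← add_smul]
      congr 1
      push_cast
      ring
  induction f using Polynomial.induction_on' with
  | add f g hf hg =>
    simp only [map_add, mul_add, add_mul, smul_add, ← hf, ← hg]
    abel
  | monomial n r =>
    cases n with
    | zero => simp [Algebra.commutes]
    | succ n =>
      rw [Polynomial.derivative_monomial, Polynomial.aeval_monomial, Polynomial.aeval_monomial,
        ← Algebra.smul_def, ← Algebra.smul_def, mul_smul_comm, smul_mul_assoc, ← smul_sub, hpow,
        Nat.add_sub_cancel, smul_mul_assoc, smul_smul, smul_smul]
      congr 1
      push_cast
      ring

/-- If `[x,q] = εp`, `[x,p] = q`, `[p,q] = 0` and `ε ≠ 0`, then `p` is nilpotent. -/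
theorem exists_pow_eq_zero {a : Type v} [AddCommGroup a] [Module ℝ a] [FiniteDimensional ℝ a]
    {x p q : Module.End ℝ a} {ε : ℝ} (hε : ε ≠ 0) (hq : x * q - q * x = ε • p)
    (hp : x * p - p * x = q) (hpq : p * q = q * p) : ∃ N, p ^ N = 0 := by
  -- Commuting f(q)pʲ = 0 with x and multiplying by p kills the term from [x, pʲ] and leaves ε
  -- f'(q)p^(j+2) = 0. Differentiating down to a non-zero constant gives nilpotency; Cayley–Hamilton
  -- supplies the first f.
  have key : ∀ n : ℕ, ∀ f : Polynomial ℝ, f ≠ 0 → f.natDegree ≤ n → ∀ j,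
      Polynomial.aeval q f * p ^ j = 0 → ∃ N, p ^ N = 0 := by
    intro n
    induction n with
    | zero =>
      intro f hf hn j hj
      rw [Polynomial.eq_C_of_natDegree_le_zero hn] at hf hj
      rw [Polynomial.aeval_C, ← Algebra.smul_def] at hj
      refine ⟨j, (smul_eq_zero.1 hj).resolve_left fun h => hf ?_⟩
      rw [h, map_zero]
    | succ n ih =>
      intro f hf hn j hj
      by_cases h0 : f.natDegree = 0
      · exact ih f hf (by omega) j hj
      · refine ih (Polynomial.derivative f) ?_ ?_ (j + 2) ?_
        · intro h
          exact h0 (Polynomial.derivative_eq_zero.1 h)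
        · have := Polynomial.natDegree_derivative_lt h0
          omega
        · have h1 := mul_aeval_sub_aeval_mul hq hpq f
          have h2 := mul_pow_sub_pow_mul hp hpq j
          have hc : Polynomial.aeval q f * q = q * Polynomial.aeval q f := by
            have h := congrArg (Polynomial.aeval q) (mul_comm f Polynomial.X)
            rwa [map_mul, map_mul, Polynomial.aeval_X] at h
          have h3 : (x * Polynomial.aeval q f - Polynomial.aeval q f * x) * p ^ j * p
              = (x * (Polynomial.aeval q f * p ^ j) - (Polynomial.aeval q f * p ^ j) * x) * p
                - Polynomial.aeval q f * ((x * p ^ j - p ^ j * x) * p) := by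
            noncomm_ring
          rw [h1, hj, h2, mul_smul_comm, ← mul_assoc (Polynomial.aeval q f), hc,
            mul_assoc q, hj] at h3
          simp only [mul_zero, zero_mul, sub_zero, smul_zero, smul_mul_assoc] at h3
          have h4 := (smul_eq_zero.1 h3).resolve_left hε
          have h5 : p ^ (j + 2) = p * (p ^ j * p) := by rw [pow_succ, pow_succ', mul_assoc]
          rw [← h4, h5]
          simp only [mul_assoc]
  refine key _ q.charpoly q.charpoly_monic.ne_zero le_rfl 0 ?_
  rw [LinearMap.aeval_self_charpoly, zero_mul]

section General

variable {l : Type u} [LieRing l] [LieAlgebra ℝ l] {θ : LieInvolution l}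
  {a : Type v} [AddCommGroup a] [Module ℝ a] [LieRingModule l a] [LieModule ℝ l a]

namespace Frame

variable (F : Frame θ)

omit [Module ℝ a] [LieModule ℝ l a] in
theorem lie_Q_lie_P (A : a) : ⁅F.Q, ⁅F.P, A⁆⁆ = ⁅F.P, ⁅F.Q, A⁆⁆ := by
  rw [leibniz_lie, F.lie_QP, zero_lie, zero_add]

theorem exists_pow_P_Q [FiniteDimensional ℝ a] :
    ∃ N, LieModule.toEnd ℝ l a F.P ^ N = 0 ∧ LieModule.toEnd ℝ l a F.Q ^ N = 0 := by
  have hpq : LieModule.toEnd ℝ l a F.P * LieModule.toEnd ℝ l a F.Q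
      = LieModule.toEnd ℝ l a F.Q * LieModule.toEnd ℝ l a F.P := by
    ext A
    simp only [Module.End.mul_apply, LieModule.toEnd_apply_apply, F.lie_Q_lie_P]
  have hp : LieModule.toEnd ℝ l a F.X * LieModule.toEnd ℝ l a F.P
      - LieModule.toEnd ℝ l a F.P * LieModule.toEnd ℝ l a F.X = LieModule.toEnd ℝ l a F.Q := by
    ext A
    simp only [Module.End.mul_apply, LieModule.toEnd_apply_apply, LinearMap.sub_apply,
      ← lie_lie, F.lie_XP]
  have hq : LieModule.toEnd ℝ l a F.X * LieModule.toEnd ℝ l a F.Q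
      - LieModule.toEnd ℝ l a F.Q * LieModule.toEnd ℝ l a F.X
        = F.ε • LieModule.toEnd ℝ l a F.P := by
    ext A
    simp only [Module.End.mul_apply, LieModule.toEnd_apply_apply, LinearMap.sub_apply,
      LinearMap.smul_apply, ← lie_lie, F.lie_XQ, smul_lie]
  obtain ⟨N, hN⟩ := exists_pow_eq_zero F.ε_ne hq hp hpq
  -- The hypotheses are symmetric under (p, q) ↦ (q, εp), so Q is nilpotent too.
  obtain ⟨N', hN'⟩ := exists_pow_eq_zero (x := LieModule.toEnd ℝ l a F.X)
    (p := LieModule.toEnd ℝ l a F.Q) (q := F.ε • LieModule.toEnd ℝ l a F.P) F.ε_ne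
    (by rw [mul_smul_comm, smul_mul_assoc, ← smul_sub, hp]) hq
    (by rw [mul_smul_comm, smul_mul_assoc, hpq])
  exact ⟨N + N', by rw [pow_add, hN, zero_mul], by rw [pow_add, hN', mul_zero]⟩

theorem lie_apply_eq (L : l) (A : a) : ⁅L, A⁆ =
    F.b.coord 0 L • ⁅F.X, A⁆ + F.b.coord 1 L • ⁅F.P, A⁆ + F.b.coord 2 L • ⁅F.Q, A⁆ := by
  conv_lhs => rw [F.eq_sum L]
  simp only [add_lie, smul_lie]

/-- On a semi-simple module, the derived algebra acts trivially. -/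
theorem lie_P_eq_zero_and_lie_Q_eq_zero [FiniteDimensional ℝ a] (hs : SemisimpleModule l a)
    (A : a) : ⁅F.P, A⁆ = 0 ∧ ⁅F.Q, A⁆ = 0 := by
  -- The common kernel of P and Q is a submodule, as P and Q span an ideal. A complement on which
  -- both are nilpotent must vanish: a non-zero element would produce, by applying P and then Q, a
  -- non-zero element of the common kernel.
  let b : LieSubmodule ℝ l a :=
    { carrier := {A | ⁅F.P, A⁆ = 0 ∧ ⁅F.Q, A⁆ = 0}
      add_mem' := fun {A B} hA hB => by
        obtain ⟨hA, hA'⟩ := hA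
        obtain ⟨hB, hB'⟩ := hB
        exact ⟨by rw [lie_add, hA, hB, add_zero], by rw [lie_add, hA', hB', add_zero]⟩
      zero_mem' := by simp
      smul_mem' := fun r A hA => by
        obtain ⟨hA, hA'⟩ := hA
        exact ⟨by rw [lie_smul, hA, smul_zero], by rw [lie_smul, hA', smul_zero]⟩
      lie_mem := fun {L A} hA => by
        have hA' : ⁅F.P, A⁆ = 0 ∧ ⁅F.Q, A⁆ = 0 := hA
        show ⁅F.P, ⁅L, A⁆⁆ = 0 ∧ ⁅F.Q, ⁅L, A⁆⁆ = 0
        rw [leibniz_lie F.P, leibniz_lie F.Q, hA'.1, hA'.2, lie_zero, add_zero, add_zero,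
          F.lie_apply_eq, F.lie_apply_eq ⁅F.Q, L⁆, hA'.1, hA'.2, F.coord_zero_lie,
          F.coord_zero_lie]
        simp }
  obtain ⟨c, hc, hd⟩ := hs.exists_complement b
  obtain ⟨N, hP, hQ⟩ := F.exists_pow_P_Q (a := a)
  have h1 : ∀ k : ℕ, ∀ C ∈ c, ⁅F.P, C⁆ = 0 → (LieModule.toEnd ℝ l a F.Q ^ k) C = 0 → C = 0 := by
    intro k
    induction k with
    | zero => intro C _ _ h; simpa using h
    | succ k ih =>
      intro C hC hPC h
      rw [pow_succ, Module.End.mul_apply, LieModule.toEnd_apply_apply] at h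
      have := ih ⁅F.Q, C⁆ (c.lie_mem hC) (by rw [← F.lie_Q_lie_P, hPC, lie_zero]) h
      exact hd C ⟨hPC, this⟩ hC
  have h2 : ∀ k : ℕ, ∀ C ∈ c, (LieModule.toEnd ℝ l a F.P ^ k) C = 0 → C = 0 := by
    intro k
    induction k with
    | zero => intro C _ h; simpa using h
    | succ k ih =>
      intro C hC h
      rw [pow_succ, Module.End.mul_apply, LieModule.toEnd_apply_apply] at h
      exact h1 N C hC (ih ⁅F.P, C⁆ (c.lie_mem hC) h) (by rw [hQ, LinearMap.zero_apply])
  obtain ⟨B, hB, C, hC, rfl⟩ := hc A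
  rw [h2 N C hC (by rw [hP, LinearMap.zero_apply]), add_zero]
  exact hB

/-- The action on a semi-simple module is determined by the action of `X`. -/
theorem lie_apply [FiniteDimensional ℝ a] (hs : SemisimpleModule l a) (L : l) (A : a) :
    ⁅L, A⁆ = F.b.coord 0 L • ⁅F.X, A⁆ := by
  rw [F.lie_apply_eq, (F.lie_P_eq_zero_and_lie_Q_eq_zero hs A).1,
    (F.lie_P_eq_zero_and_lie_Q_eq_zero hs A).2, smul_zero, smul_zero, add_zero, add_zero]

theorem mem_inv_iff [FiniteDimensional ℝ a] (hs : SemisimpleModule l a) (M : OrthModule θ a)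
    {A : a} : A ∈ M.inv ↔ ⁅F.X, A⁆ = 0 :=
  ⟨fun h => h F.X, fun h L => by rw [F.lie_apply hs, h, smul_zero]⟩

/-- A subspace stable under `ρ(X)` is a submodule. -/
def submodule [FiniteDimensional ℝ a] (hs : SemisimpleModule l a) (N : Submodule ℝ a)
    (hN : ∀ A ∈ N, ⁅F.X, A⁆ ∈ N) : LieSubmodule ℝ l a :=
  { N with
    lie_mem := fun {L A} hA => by
      rw [F.lie_apply hs]
      exact N.smul_mem _ (hN A hA) }

/-! ### Splitting the module by ρ(X)² - ε -/

/-- The operator `ρ(X)² - ε`. -/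
noncomputable def opf (a : Type v) [AddCommGroup a] [Module ℝ a] [LieRingModule l a]
    [LieModule ℝ l a] : a →ₗ[ℝ] a :=
  LieModule.toEnd ℝ l a F.X ∘ₗ LieModule.toEnd ℝ l a F.X - F.ε • LinearMap.id

theorem opf_apply (A : a) : F.opf a A = ⁅F.X, ⁅F.X, A⁆⁆ - F.ε • A := rfl

theorem lie_opf (A : a) : ⁅F.X, F.opf a A⁆ = F.opf a ⁅F.X, A⁆ := by
  simp only [opf_apply, lie_sub, lie_smul]

theorem form_opf (M : OrthModule θ a) (A B : a) :
    M.form (F.opf a A) B = M.form A (F.opf a B) := by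
  simp only [opf_apply, map_sub, LinearMap.sub_apply, map_smul, LinearMap.smul_apply,
    skew_left M, neg_neg]

/-- On each submodule, `ρ(X)² - ε` is the direct sum of zero and a surjective map. -/
theorem exists_add_opf [FiniteDimensional ℝ a] (hs : SemisimpleModule l a)
    (b : LieSubmodule ℝ l a) {B : a} (hB : B ∈ b) :
    ∃ B₀ ∈ b, ∃ B₁ ∈ b, B = B₀ + F.opf a B₁ ∧ F.opf a B₀ = 0 := by
  -- Let c complement the image f(b). The c-component B₀ of B stays in b, so f(B₀) lies in f(b) ∩ c
  -- = 0.
  obtain ⟨c, hc, hd⟩ := hs.exists_complement (F.submodule hs (b.toSubmodule.map (F.opf a)) (by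
    rintro _ ⟨A, hA, rfl⟩
    exact ⟨⁅F.X, A⁆, b.lie_mem hA, (F.lie_opf A).symm⟩))
  have hbf : ∀ A ∈ b, F.opf a A ∈ b := fun A hA =>
    sub_mem (b.lie_mem (b.lie_mem hA)) (b.smul_mem _ hA)
  obtain ⟨_, ⟨B₁, hB₁, rfl⟩, B₀, hB₀, h⟩ := hc B
  have hB₀b : B₀ ∈ b := by
    rw [← add_sub_cancel_left (F.opf a B₁) B₀, h]
    exact sub_mem hB (hbf _ hB₁)
  refine ⟨B₀, hB₀b, B₁, hB₁, by rw [← h, add_comm], hd _ ⟨B₀, hB₀b, rfl⟩ ?_⟩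
  exact sub_mem (c.lie_mem (c.lie_mem hB₀)) (c.smul_mem _ hB₀)

/-- The operator is self-adjoint, so f(A) with f(f(A)) = 0 is orthogonal to both ker f and im f,
which together span a. -/
theorem opf_eq_zero_of_opf_opf [FiniteDimensional ℝ a] (hs : SemisimpleModule l a)
    (M : OrthModule θ a) {A : a} (h : F.opf a (F.opf a A) = 0) : F.opf a A = 0 := by
  refine M.eq_zero_of_form_left fun B => ?_
  obtain ⟨B₀, -, B₁, -, rfl, h₀⟩ := F.exists_add_opf hs ⊤ (LieSubmodule.mem_top B)
  rw [map_add, F.form_opf, h₀, map_zero, ← F.form_opf, h, map_zero, LinearMap.zero_apply,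
    add_zero]

theorem theta_lie_X (M : OrthModule θ a) (A : a) : M.theta ⁅F.X, A⁆ = -⁅F.X, M.theta A⁆ := by
  rw [← M.compat, F.theta_X, neg_lie, map_neg, neg_neg]

theorem theta_opf (M : OrthModule θ a) (A : a) : M.theta (F.opf a A) = F.opf a (M.theta A) := by
  simp only [opf_apply, map_sub, map_smul, F.theta_lie_X, lie_neg, neg_neg]

/-- The decomposition with respect to `ρ(X)² - ε` respects `a₋`. -/
theorem exists_add_opf_minus [FiniteDimensional ℝ a] (hs : SemisimpleModule l a)
    (M : OrthModule θ a) {A : a} (hA : M.theta A = -A) :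
    ∃ B C, A = B + F.opf a C ∧ F.opf a B = 0 ∧ M.theta B = -B ∧ M.theta C = -C := by
  obtain ⟨B, -, C, -, h, hB⟩ := F.exists_add_opf hs ⊤ (LieSubmodule.mem_top A)
  refine ⟨(1 / 2 : ℝ) • (B - M.theta B), (1 / 2 : ℝ) • (C - M.theta C), ?_, ?_, ?_, ?_⟩
  · have h2 : A = (1 / 2 : ℝ) • (A - M.theta A) := by rw [hA]; module
    rw [h2, h, map_add, F.theta_opf, map_smul, map_sub]
    module
  · rw [map_smul, map_sub, ← F.theta_opf, hB]; simp
  · rw [map_smul, map_sub, M.theta_invol]; module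
  · rw [map_smul, map_sub, M.theta_invol]; module

/-! ### Cochains in coordinates -/

theorem twoCochain_eq {m : Type*} [AddCommGroup m] [Module ℝ m] (α : twoCochain ℝ l m) (x y : l) :
    α x y =
      (F.b.coord 0 x * F.b.coord 1 y - F.b.coord 1 x * F.b.coord 0 y) • α F.X F.P +
      (F.b.coord 0 x * F.b.coord 2 y - F.b.coord 2 x * F.b.coord 0 y) • α F.X F.Q +
      (F.b.coord 1 x * F.b.coord 2 y - F.b.coord 2 x * F.b.coord 1 y) • α F.P F.Q := by
  conv_lhs => rw [F.eq_sum x, F.eq_sum y]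
  simp only [map_add, map_smul, LinearMap.add_apply, LinearMap.smul_apply, twoCochain_alt,
    ← twoCochain_skew α F.X F.P, ← twoCochain_skew α F.X F.Q, ← twoCochain_skew α F.P F.Q]
  module

theorem twoCochain_ext {m : Type*} [AddCommGroup m] [Module ℝ m] {α β : twoCochain ℝ l m}
    (h₁ : α F.X F.P = β F.X F.P) (h₂ : α F.X F.Q = β F.X F.Q) (h₃ : α F.P F.Q = β F.P F.Q) :
    α = β := by
  refine DFunLike.ext _ _ fun x => LinearMap.ext fun y => ?_
  rw [F.twoCochain_eq α, F.twoCochain_eq β, h₁, h₂, h₃]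

/-- The volume form. -/
noncomputable def vol (x y z : l) : ℝ :=
  F.b.coord 0 x * (F.b.coord 1 y * F.b.coord 2 z - F.b.coord 2 y * F.b.coord 1 z)
    - F.b.coord 1 x * (F.b.coord 0 y * F.b.coord 2 z - F.b.coord 2 y * F.b.coord 0 z)
    + F.b.coord 2 x * (F.b.coord 0 y * F.b.coord 1 z - F.b.coord 1 y * F.b.coord 0 z)

theorem det_eq_vol (x y z : l) : F.b.det ![x, y, z] = F.vol x y z := by
  rw [Module.Basis.det_apply, Matrix.det_fin_three, vol]
  simp [Module.Basis.toMatrix_apply, Module.Basis.coord_apply]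
  ring

theorem vol_XPQ : F.vol F.X F.P F.Q = 1 := by
  simp only [vol, F.coord_X, F.coord_P, F.coord_Q]
  norm_num

theorem threeForm_eq (γ : ThreeForm l) (x y z : l) :
    γ ![x, y, z] = γ ![F.X, F.P, F.Q] * F.vol x y z := by
  have h := γ.eq_smul_basis_det F.b
  have hb : (F.b : Fin 3 → l) = ![F.X, F.P, F.Q] := by
    funext i; fin_cases i <;> rfl
  conv_lhs => rw [h]
  rw [AlternatingMap.smul_apply, F.det_eq_vol, smul_eq_mul, hb]

/-- The 3-form with value `t` at `X, P, Q`. -/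
noncomputable def threeForm (t : ℝ) : ThreeForm l := t • F.b.det

theorem threeForm_apply (t : ℝ) (x y z : l) : F.threeForm t ![x, y, z] = t * F.vol x y z := by
  rw [threeForm, AlternatingMap.smul_apply, F.det_eq_vol, smul_eq_mul]

theorem threeForm_ext {γ δ : ThreeForm l} (h : γ ![F.X, F.P, F.Q] = δ ![F.X, F.P, F.Q]) :
    γ = δ := by
  ext v
  have hv : v = ![v 0, v 1, v 2] := by
    funext i; fin_cases i <;> rfl
  rw [hv, F.threeForm_eq γ, F.threeForm_eq δ, h]

/-- The algebra is unimodular: every ad L is traceless, so 2-forms are closed. -/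
theorem dTwo_eq_zero (F : Frame θ) (σ : twoCochain ℝ l ℝ) (x y z : l) : dTwo σ x y z = 0 := by
  simp only [dTwo, F.twoCochain_eq σ ⁅_, _⁆, F.coord_zero_lie, F.coord_one_lie, F.coord_two_lie,
    smul_eq_mul]
  ring

/-- This is a 4-form on a 3-dimensional space, and so is ⟨α ∧ α⟩ below; the quadratic cocycle
equation is thus vacuous. -/
theorem dThree_eq_zero (F : Frame θ) (γ : ThreeForm l) (w x y z : l) : dThree γ w x y z = 0 := by
  simp only [dThree, F.threeForm_eq γ ⁅_, _⁆, vol, F.coord_zero_lie, F.coord_one_lie,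
    F.coord_two_lie]
  ring

theorem wedgeTwoTwo_eq_zero (F : Frame θ) (M : OrthModule θ a) (α : twoCochain ℝ l a) (w x y z : l) :
    wedgeTwoTwo M α α w x y z = 0 := by
  simp only [wedgeTwoTwo, F.twoCochain_eq α w, F.twoCochain_eq α x, F.twoCochain_eq α y]
  simp only [map_add, map_smul, LinearMap.add_apply, LinearMap.smul_apply, smul_eq_mul,
    M.symm (α F.X F.Q) (α F.X F.P), M.symm (α F.P F.Q) (α F.X F.P),
    M.symm (α F.P F.Q) (α F.X F.Q)]
  ring

theorem linearMap_eq {m : Type*} [AddCommGroup m] [Module ℝ m] (τ : l →ₗ[ℝ] m) (x : l) :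
    τ x = F.b.coord 0 x • τ F.X + F.b.coord 1 x • τ F.P + F.b.coord 2 x • τ F.Q := by
  conv_lhs => rw [F.eq_sum x]
  simp only [map_add, map_smul]

theorem wedgeTwoOne_eq (M : OrthModule θ a) (α : twoCochain ℝ l a) (τ : l →ₗ[ℝ] a) (x y z : l) :
    wedgeTwoOne M α τ x y z = wedgeTwoOne M α τ F.X F.P F.Q * F.vol x y z := by
  simp only [wedgeTwoOne, F.twoCochain_eq α x, F.twoCochain_eq α y, F.linearMap_eq τ x,
    F.linearMap_eq τ y, F.linearMap_eq τ z, vol]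
  simp only [map_add, map_smul, LinearMap.add_apply, LinearMap.smul_apply, smul_eq_mul]
  ring

/-- With P and Q acting by zero, dα(X,P,Q) is just ρ(X)α(P,Q). The other conditions are
θ-equivariance on the basis. -/
theorem isCocycle_iff [FiniteDimensional ℝ a] (hs : SemisimpleModule l a) (M : OrthModule θ a)
    (α : twoCochain ℝ l a) (γ : ThreeForm l) :
    IsCocycle M α γ ↔ α F.P F.Q ∈ M.inv ∧ M.theta (α F.P F.Q) = -α F.P F.Q ∧
      M.theta (α F.X F.P) = α F.X F.P ∧ M.theta (α F.X F.Q) = -α F.X F.Q := by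
  constructor
  · rintro ⟨h1, -, h3, -⟩
    refine ⟨?_, ?_, ?_, ?_⟩
    · rw [F.mem_inv_iff hs]
      have h := congrArg (fun f => f F.X F.P F.Q) h1
      simp only [d₂₃_apply, (F.lie_P_eq_zero_and_lie_Q_eq_zero hs _).1,
        (F.lie_P_eq_zero_and_lie_Q_eq_zero hs _).2, F.lie_XP, F.lie_XQ, F.lie_PQ,
        twoCochain_alt, map_smul, LinearMap.smul_apply, map_zero, LinearMap.zero_apply] at h
      simpa using h
    · have h := h3 F.P F.Q
      rw [F.theta_P, F.theta_Q, map_neg, LinearMap.neg_apply, map_neg] at h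
      exact neg_eq_iff_eq_neg.1 h
    · have h := h3 F.X F.P
      rwa [F.theta_P, F.theta_X, map_neg, map_neg, map_neg, LinearMap.neg_apply, map_neg,
        neg_neg] at h
    · have h := h3 F.X F.Q
      rw [F.theta_X, F.theta_Q, map_neg, LinearMap.neg_apply, map_neg] at h
      exact neg_eq_iff_eq_neg.1 h
  · rintro ⟨h1, h2, h3, h4⟩
    rw [F.mem_inv_iff hs] at h1
    refine ⟨?_, fun w x y z => ?_, fun x y => ?_, fun x y z => ?_⟩
    · ext x y z
      rw [d₂₃_apply]
      simp only [F.twoCochain_eq α x, F.twoCochain_eq α y, F.twoCochain_eq α ⁅_, _⁆,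
        F.lie_apply hs x, F.lie_apply hs y, F.lie_apply hs z, lie_add, lie_smul, h1, F.coord_zero_lie,
        F.coord_one_lie, F.coord_two_lie, LinearMap.zero_apply]
      module
    · rw [F.dThree_eq_zero, F.wedgeTwoTwo_eq_zero, mul_zero]
    · rw [F.twoCochain_eq α (θ.toHom x), F.twoCochain_eq α x y]
      simp only [F.coord_theta, map_add, map_smul, h2, h3, h4]
      module
    -- Invariance of γ is automatic because det θ = 1.
    · rw [F.threeForm_eq, F.threeForm_eq γ x y z]
      simp only [vol, F.coord_theta]
      ring

/-! ### The radical series and the socle -/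

/-- The derived algebra, spanned by `P` and `Q`. -/
noncomputable def derived : LieIdeal ℝ l :=
  { LinearMap.ker (F.b.coord 0) with
    lie_mem := fun {L K} _ => F.coord_zero_lie L K }

theorem mem_derived {L : l} : L ∈ F.derived ↔ F.b.coord 0 L = 0 := Iff.rfl

theorem P_mem : F.P ∈ F.derived := F.coord_P.1

theorem Q_mem : F.Q ∈ F.derived := F.coord_Q.1

theorem eq_of_mem_derived {K : l} (hK : K ∈ F.derived) :
    K = F.b.coord 1 K • F.P + F.b.coord 2 K • F.Q := by
  conv_lhs => rw [F.eq_sum K, F.mem_derived.1 hK, zero_smul, zero_add]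

theorem lie_eq_of_mem_derived {K : l} (hK : K ∈ F.derived) (L : l) :
    ⁅L, K⁆ = F.b.coord 0 L • ⁅F.X, K⁆ := by
  rw [F.lie_eq, F.lie_eq F.X, F.mem_derived.1 hK]
  simp only [F.coord_X]
  module

theorem lie_X_lie_X {K : l} (hK : K ∈ F.derived) : ⁅F.X, ⁅F.X, K⁆⁆ = F.ε • K := by
  rw [F.eq_of_mem_derived hK]
  simp only [lie_add, lie_smul, F.lie_XP, F.lie_XQ, smul_add]
  module

/-- Bracketing V with Q and P yields non-zero multiples of P and Q. -/
theorem le_of_derived_le {I : LieIdeal ℝ l} {V : l} (hV : V ∈ I) (h0 : F.b.coord 0 V ≠ 0) :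
    F.derived ≤ I := by
  have hP : F.P ∈ I := by
    have h : ⁅F.Q, V⁆ = (-(F.ε * F.b.coord 0 V)) • F.P := by
      rw [F.lie_eq]; simp only [F.coord_Q]; module
    have h2 : ⁅F.Q, V⁆ ∈ I := I.lie_mem hV
    rw [h] at h2
    exact (I.toSubmodule.smul_mem_iff (neg_ne_zero.2 (mul_ne_zero F.ε_ne h0))).1 h2
  have hQ : F.Q ∈ I := by
    have h : ⁅F.P, V⁆ = (-F.b.coord 0 V) • F.Q := by
      rw [F.lie_eq]; simp only [F.coord_P]; module
    have h2 : ⁅F.P, V⁆ ∈ I := I.lie_mem hV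
    rw [h] at h2
    exact (I.toSubmodule.smul_mem_iff (neg_ne_zero.2 h0)).1 h2
  intro K hK
  rw [F.eq_of_mem_derived hK]
  exact add_mem (I.smul_mem _ hP) (I.smul_mem _ hQ)

theorem semisimpleQuotient_derived_top : SemisimpleQuotient F.derived ⊤ := by
  intro K hK _
  by_cases h : K ≤ F.derived
  · exact ⟨⊤, le_top, le_rfl, by rw [inf_top_eq]; exact le_antisymm h hK, sup_top_eq K⟩
  · obtain ⟨V, hV, hV'⟩ := Set.not_subset.1 (show ¬ (K : Set l) ⊆ F.derived from h)
    have hX : K = ⊤ := by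
      rw [eq_top_iff]
      intro L _
      have h0 : F.b.coord 0 V ≠ 0 := hV'
      have h1 : L - (F.b.coord 0 L / F.b.coord 0 V) • V ∈ F.derived := by
        rw [F.mem_derived, map_sub, map_smul, smul_eq_mul]
        field_simp
        ring
      have h2 := add_mem (hK h1) (K.smul_mem (F.b.coord 0 L / F.b.coord 0 V) hV)
      rwa [sub_add_cancel] at h2
    exact ⟨F.derived, le_rfl, le_top, by rw [inf_eq_right.2 hK], by rw [hX, top_sup_eq]⟩

/-- A complement K' of I + [l,l] modulo I contains an element with non-zero X-coordinate, hence
contains [l,l]; so [l,l] lies in the intersection, which is I. -/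
theorem derived_le_of_semisimpleQuotient {I : LieIdeal ℝ l} (h : SemisimpleQuotient I ⊤) :
    F.derived ≤ I := by
  obtain ⟨K', hI, -, h1, h2⟩ := h (I ⊔ F.derived) le_sup_left le_top
  have hX : F.X ∈ (I ⊔ F.derived) ⊔ K' := by rw [h2]; trivial
  obtain ⟨V, hV, W, hW, hVW⟩ := (LieSubmodule.mem_sup _ _ _).1 hX
  obtain ⟨U, hU, D, hD, rfl⟩ := (LieSubmodule.mem_sup _ _ _).1 hV
  have hK : F.b.coord 0 (U + W) ≠ 0 := by
    have := congrArg (F.b.coord 0) hVW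
    rw [map_add, map_add, F.mem_derived.1 hD, add_zero, F.coord_X.1] at this
    rw [map_add, this]
    exact one_ne_zero
  have h3 : F.derived ≤ K' := F.le_of_derived_le (add_mem (hI hU) hW) hK
  rw [← h1]
  exact le_inf le_sup_right h3

/-- ad X is annihilated by T(T² - ε), which is squarefree as ε ≠ 0, so ad X is semi-simple. On [l,l]
every L acts as a multiple of ad X, so ad X-stable complements there are ideals. -/
theorem semisimpleQuotient_bot_derived : SemisimpleQuotient ⊥ F.derived := by
  intro K _ hK
  have hs : (LieAlgebra.ad ℝ l F.X).IsSemisimple := by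
    refine Module.End.isSemisimple_of_squarefree_aeval_eq_zero
      (p := Polynomial.X * (Polynomial.X ^ 2 - Polynomial.C F.ε)) ?_ ?_
    · have h1 : (Polynomial.X ^ 2 - Polynomial.C F.ε : Polynomial ℝ).Separable :=
        Polynomial.separable_X_pow_sub_C F.ε (by norm_num) F.ε_ne
      refine (Polynomial.Separable.mul Polynomial.separable_X h1 ?_).squarefree
      refine ⟨Polynomial.C (F.ε⁻¹) * Polynomial.X, -Polynomial.C (F.ε⁻¹), ?_⟩
      have : (Polynomial.C F.ε⁻¹ * Polynomial.C F.ε : Polynomial ℝ) = 1 := by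
        rw [← Polynomial.C_mul, inv_mul_cancel₀ F.ε_ne, Polynomial.C_1]
      linear_combination this
    · ext1 L
      have h := F.lie_X_lie_X (K := ⁅F.X, L⁆) (F.coord_zero_lie _ _)
      rw [mul_sub, mul_comm Polynomial.X (Polynomial.C F.ε)]
      simp only [map_sub, map_mul, Polynomial.aeval_X, Polynomial.aeval_C,
        LinearMap.sub_apply, Module.End.mul_apply, pow_two, Module.algebraMap_end_apply,
        LieAlgebra.ad_apply, h, sub_self, LinearMap.zero_apply]
  rw [Module.End.isSemisimple_iff] at hs
  obtain ⟨q, hq, hKq⟩ := hs K.toSubmodule fun L hL => K.lie_mem hL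
  -- Cut the complement in l down to [l,l]; by the modular law it complements K there.
  refine ⟨{ q ⊓ LinearMap.ker (F.b.coord 0) with
    lie_mem := fun {L W} hW => ⟨?_, F.coord_zero_lie L W⟩ }, bot_le, fun W hW => hW.2, ?_, ?_⟩
  · rw [F.lie_eq_of_mem_derived hW.2]
    exact q.smul_mem _ (hq hW.1)
  · rw [eq_bot_iff]
    rintro L ⟨h1, h2⟩
    have : L ∈ K.toSubmodule ⊓ q := ⟨h1, h2.1⟩
    rwa [hKq.inf_eq_bot] at this
  · refine le_antisymm (sup_le hK fun W hW => hW.2) fun L hL => ?_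
    have : L ∈ K.toSubmodule ⊔ q := by rw [hKq.sup_eq_top]; trivial
    obtain ⟨V, hV, W, hW, rfl⟩ := Submodule.mem_sup.1 this
    refine (LieSubmodule.mem_sup _ _ _).2 ⟨V, hV, W, ⟨hW, ?_⟩, rfl⟩
    have h := sub_mem hL (hK hV)
    rw [add_sub_cancel_left] at h
    exact h

theorem rad_one : Rad l 1 = F.derived := by
  apply le_antisymm
  · exact sInf_le ⟨le_top, F.semisimpleQuotient_derived_top⟩
  · exact le_sInf fun I hI => F.derived_le_of_semisimpleQuotient hI.2

theorem rad_eq_bot (F : Frame θ) (k : ℕ) : Rad l (k + 2) = ⊥ := by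
  induction k with
  | zero =>
    rw [eq_bot_iff]
    refine sInf_le ⟨bot_le, ?_⟩
    rw [F.rad_one]
    exact F.semisimpleQuotient_bot_derived
  | succ k ih =>
    rw [eq_bot_iff]
    refine sInf_le ⟨bot_le, ?_⟩
    rw [ih]
    exact fun K _ hK => ⟨⊥, le_rfl, le_rfl, inf_bot_eq K, by rw [sup_bot_eq]; exact eq_bot_iff.2 hK⟩

theorem derived_le_soc : F.derived ≤ Soc l := le_sSup F.semisimpleQuotient_bot_derived

theorem lie_eq_zero_of_mem_rad (F : Frame θ) [FiniteDimensional ℝ a] (hs : SemisimpleModule l a) {K : l}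
    (hK : K ∈ Rad l 1) (A : a) : ⁅K, A⁆ = 0 := by
  rw [F.rad_one] at hK
  rw [F.lie_apply hs, F.mem_derived.1 hK, zero_smul]

end Frame

/-! ### Dependence of the admissibility conditions on the representative -/

/-- Solvability of the equations in `(B₁)` depends on the class of `α` only. -/
theorem solvableOn_of_eq_add {M : OrthModule θ a} {α β : twoCochain ℝ l a} {τ : l →ₗ[ℝ] a}
    (hβ : β = α + d₁₂ ℝ l a τ) {k : ℕ} (hk : ∀ K ∈ Rad l k, ∀ A : a, ⁅K, A⁆ = 0)
    {b : LieSubmodule ℝ l a} (h : SolvableOn M α k b) : SolvableOn M β k b := by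
  obtain ⟨Φ, hΦ⟩ := h
  -- As R_k acts by zero, dτ(L,K) = ρ(L)τ(K) - τ([L,K]) has the form of the right-hand side in
  -- `SolvableOn`, so τ is absorbed into Φ.
  refine ⟨Φ + τ ∘ₗ (Rad l k).toSubmodule.subtype, fun L K B hB => ?_⟩
  have h1 := hΦ L K B hB
  have h2 : β L K = α L K + (⁅L, τ K⁆ - τ ⁅L, (K : l)⁆) := by
    rw [hβ, add_apply_apply, d₁₂_apply_apply, hk K K.2, sub_zero]
  have h3 : (Φ + τ ∘ₗ (Rad l k).toSubmodule.subtype) K = Φ K + τ K := rfl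
  have h4 : (Φ + τ ∘ₗ (Rad l k).toSubmodule.subtype) ⁅L, K⁆ = Φ ⁅L, K⁆ + τ ⁅L, (K : l)⁆ := rfl
  rw [h2, h3, h4, map_add, LinearMap.add_apply, h1]
  simp only [map_add, map_sub, LinearMap.add_apply, LinearMap.sub_apply, lie_add]
  ring

/-- If `R₁` is abelian and acts trivially on `a`, then `(A₁)` fails for each representative
of `[0,0]`. -/
theorem rad_one_eq_bot_of_condA {M : OrthModule θ a}
    (hR : ∀ K ∈ Rad l 1, ∀ A : a, ⁅K, A⁆ = 0) (hab : ∀ K ∈ Rad l 1, ∀ W ∈ Rad l 1, ⁅K, W⁆ = 0)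
    (hS : Rad l 1 ≤ Soc l) {τ : l →ₗ[ℝ] a} {γ : ThreeForm l}
    (hγ : ∀ x y z, γ ![x, y, z] = wedgeTwoOne M ((1 / 2 : ℝ) • d₁₂ ℝ l a τ) τ x y z)
    (hA : CondA M (d₁₂ ℝ l a τ) γ 1) : Rad l 1 = ⊥ := by
  -- Take Φ₁ = τ and Φ₂(K) = -½⟨τ(K), τ(·)⟩. The factor ½ comes from γ = ½⟨dτ ∧ τ⟩: skewness makes
  -- the two terms in ρ(L) agree, and Φ₂ accounts for the bracket terms.
  refine hA (Rad l 1) (le_inf hS le_rfl)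
    ⟨τ ∘ₗ (Rad l 1).toSubmodule.subtype,
      ((-(1 / 2 : ℝ)) • M.form.compl₁₂ τ τ).compl₁₂ (Rad l 1).toSubmodule.subtype
        (Rad l 1).toSubmodule.subtype, fun L K => ⟨?_, fun W => ?_⟩⟩
  · rw [d₁₂_apply_apply, hR K K.2, sub_zero]
    rfl
  · rw [hγ]
    show _ = -M.form (τ K) _ + (-(1 / 2 : ℝ)) * M.form (τ K) (τ ⁅L, (W : l)⁆)
      + (-(1 / 2 : ℝ)) * M.form (τ ⁅L, (K : l)⁆) (τ W)
    simp only [wedgeTwoOne, smul_apply_apply, d₁₂_apply_apply, hR K K.2, hR W W.2,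
      hab K K.2 W W.2, map_zero, sub_zero, smul_zero, LinearMap.zero_apply, add_zero, map_smul,
      map_sub, LinearMap.smul_apply, LinearMap.sub_apply, smul_eq_mul, skew_left M]
    rw [skew_right M (τ K), M.symm (τ K) (τ ⁅L, (W : l)⁆)]
    ring

/-! ### Harmonic representatives and the classification of the classes -/

namespace Frame

variable (F : Frame θ)

/-- The cochains `α` that serve as representatives of the non-zero cohomology classes of `α`. -/
structure IsHarmonic (M : OrthModule θ a) (α : twoCochain ℝ l a) : Prop where
  mem_inv : α F.P F.Q ∈ M.inv
  theta_PQ : M.theta (α F.P F.Q) = -α F.P F.Q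
  theta_XP : M.theta (α F.X F.P) = α F.X F.P
  opf_XP : F.opf a (α F.X F.P) = 0
  apply_XQ : α F.X F.Q = ⁅F.X, α F.X F.P⁆

variable {F} in
theorem IsHarmonic.theta_XQ {M : OrthModule θ a} {α : twoCochain ℝ l a}
    (h : F.IsHarmonic M α) : M.theta (α F.X F.Q) = -α F.X F.Q := by
  rw [h.apply_XQ, F.theta_lie_X, h.theta_XP]

variable {F} in
theorem IsHarmonic.isCocycle [FiniteDimensional ℝ a] (hs : SemisimpleModule l a)
    {M : OrthModule θ a} {α : twoCochain ℝ l a} (h : F.IsHarmonic M α) (γ : ThreeForm l) :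
    IsCocycle M α γ :=
  (F.isCocycle_iff hs M α γ).2 ⟨h.mem_inv, h.theta_PQ, h.theta_XP, h.theta_XQ⟩

theorem isHarmonic_zero (M : OrthModule θ a) : F.IsHarmonic M 0 := by
  have h : ∀ x y : l, (0 : twoCochain ℝ l a) x y = 0 := fun _ _ => rfl
  constructor <;> simp [h]

variable {F} in
theorem IsHarmonic.lie_XQ {M : OrthModule θ a} {α : twoCochain ℝ l a}
    (h : F.IsHarmonic M α) : ⁅F.X, α F.X F.Q⁆ = F.ε • α F.X F.P := by
  have := h.opf_XP
  rw [opf_apply, sub_eq_zero] at this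
  rw [h.apply_XQ, this]

/-- The linear map with values `t, y, z` at `X, P, Q`. -/
noncomputable def oneCochain {m : Type*} [AddCommGroup m] [Module ℝ m] (t y z : m) : l →ₗ[ℝ] m :=
  F.b.constr ℝ ![t, y, z]

theorem oneCochain_X {m : Type*} [AddCommGroup m] [Module ℝ m] (t y z : m) :
    F.oneCochain t y z F.X = t := by simp [oneCochain]

theorem oneCochain_P {m : Type*} [AddCommGroup m] [Module ℝ m] (t y z : m) :
    F.oneCochain t y z F.P = y := by simp [oneCochain]

theorem oneCochain_Q {m : Type*} [AddCommGroup m] [Module ℝ m] (t y z : m) :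
    F.oneCochain t y z F.Q = z := by simp [oneCochain]

theorem theta_oneCochain (M : OrthModule θ a) {t y z : a} (ht : M.theta t = -t)
    (hy : M.theta y = -y) (hz : M.theta z = z) (x : l) :
    M.theta (F.oneCochain t y z (θ.toHom x)) = F.oneCochain t y z x := by
  rw [F.linearMap_eq _ (θ.toHom x), F.linearMap_eq _ x, F.oneCochain_X, F.oneCochain_P,
    F.oneCochain_Q]
  simp only [F.coord_theta, map_add, map_smul, ht, hy, hz]
  module

theorem d₁₂_XP [FiniteDimensional ℝ a] (hs : SemisimpleModule l a) (τ : l →ₗ[ℝ] a) :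
    d₁₂ ℝ l a τ F.X F.P = ⁅F.X, τ F.P⁆ - τ F.Q := by
  rw [d₁₂_apply_apply, (F.lie_P_eq_zero_and_lie_Q_eq_zero hs _).1, sub_zero, F.lie_XP]

theorem d₁₂_XQ [FiniteDimensional ℝ a] (hs : SemisimpleModule l a) (τ : l →ₗ[ℝ] a) :
    d₁₂ ℝ l a τ F.X F.Q = ⁅F.X, τ F.Q⁆ - F.ε • τ F.P := by
  rw [d₁₂_apply_apply, (F.lie_P_eq_zero_and_lie_Q_eq_zero hs _).2, sub_zero, F.lie_XQ, map_smul]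

theorem d₁₂_PQ [FiniteDimensional ℝ a] (hs : SemisimpleModule l a) (τ : l →ₗ[ℝ] a) :
    d₁₂ ℝ l a τ F.P F.Q = 0 := by
  rw [d₁₂_apply_apply, (F.lie_P_eq_zero_and_lie_Q_eq_zero hs _).1,
    (F.lie_P_eq_zero_and_lie_Q_eq_zero hs _).2, F.lie_PQ, map_zero, sub_zero, sub_zero]

/-- The 2-form σ drops out because dσ = 0, and 3-forms are compared by their value at X, P, Q. -/
theorem mk_eq_mk_iff (F : Frame θ) {M : OrthModule θ a} {α β : twoCochain ℝ l a}
    {γ δ : ThreeForm l} (h : IsCocycle M α γ) (h' : IsCocycle M β δ) :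
    HQ.mk M α γ h = HQ.mk M β δ h' ↔ ∃ τ : l →ₗ[ℝ] a, (∀ x, M.theta (τ (θ.toHom x)) = τ x) ∧
      β = α + d₁₂ ℝ l a τ ∧ δ ![F.X, F.P, F.Q] = γ ![F.X, F.P, F.Q]
        + wedgeTwoOne M (α + (1 / 2 : ℝ) • d₁₂ ℝ l a τ) τ F.X F.P F.Q := by
  constructor
  · intro e
    obtain ⟨τ, σ, hτ, -, h1, h2⟩ := Quotient.exact e
    refine ⟨τ, hτ, h1, ?_⟩
    have h3 := h2 F.X F.P F.Q
    rwa [F.dTwo_eq_zero, add_zero] at h3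
  · rintro ⟨τ, hτ, h1, h2⟩
    refine Quotient.sound ⟨τ, 0, hτ, fun _ _ => rfl, h1, fun x y z => ?_⟩
    show δ ![x, y, z] = γ ![x, y, z] + _ + wedgeTwoOne M (α + _) τ x y z
    rw [F.threeForm_eq, h2, F.threeForm_eq γ x y z, F.wedgeTwoOne_eq M _ _ x y z,
      F.dTwo_eq_zero]
    ring

/-- A harmonic cochain with value `u` at `X, P` that is the coboundary of a 1-cochain with values
`y, z` at `P, Q` vanishes. -/
theorem eq_zero_of_coboundary [FiniteDimensional ℝ a] (hs : SemisimpleModule l a)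
    (M : OrthModule θ a) {u y z : a} (hu : F.opf a u = 0) (h₁ : u = ⁅F.X, y⁆ - z)
    (h₂ : ⁅F.X, u⁆ = ⁅F.X, z⁆ - F.ε • y) : u = 0 := by
  -- Eliminating z gives f(y) = 2ρ(X)u, which lies in ker f. Hence f(y) = 0 and ρ(X)u = 0, and then
  -- f(u) = 0 reads -εu = 0.
  have h3 : F.opf a y = (2 : ℝ) • ⁅F.X, u⁆ := by
    have h4 : ⁅F.X, ⁅F.X, y⁆⁆ = ⁅F.X, u⁆ + ⁅F.X, z⁆ := by rw [← lie_add, h₁, sub_add_cancel]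
    rw [opf_apply, h4, two_smul]
    nth_rewrite 3 [h₂]
    abel
  have h4 : F.opf a y = 0 := by
    refine F.opf_eq_zero_of_opf_opf hs M ?_
    rw [h3, map_smul, ← F.lie_opf, hu, lie_zero, smul_zero]
  rw [h4] at h3
  have h5 : ⁅F.X, u⁆ = 0 := (smul_eq_zero.1 h3.symm).resolve_left two_ne_zero
  rw [opf_apply, h5, lie_zero, zero_sub, neg_eq_zero] at hu
  exact (smul_eq_zero.1 hu).resolve_left F.ε_ne

-- Uniqueness of the harmonic representative: `eq_zero_of_coboundary` applied to β - α at X, P; the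
-- value at X, Q is determined by it, and coboundaries vanish at P, Q.
variable {F} in
theorem IsHarmonic.eq_of_eq_add_d₁₂ [FiniteDimensional ℝ a] (hs : SemisimpleModule l a)
    {M : OrthModule θ a} {α β : twoCochain ℝ l a} (hα : F.IsHarmonic M α)
    (hβ : F.IsHarmonic M β) {τ : l →ₗ[ℝ] a} (h : β = α + d₁₂ ℝ l a τ) : β = α := by
  have hXP : β F.X F.P = α F.X F.P + (⁅F.X, τ F.P⁆ - τ F.Q) := by
    rw [h, add_apply_apply, F.d₁₂_XP hs]
  have hXQ : β F.X F.Q = α F.X F.Q + (⁅F.X, τ F.Q⁆ - F.ε • τ F.P) := by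
    rw [h, add_apply_apply, F.d₁₂_XQ hs]
  have h0 : β F.X F.P - α F.X F.P = 0 := by
    refine F.eq_zero_of_coboundary hs M (y := τ F.P) (z := τ F.Q) ?_ ?_ ?_
    · rw [map_sub, hα.opf_XP, hβ.opf_XP, sub_zero]
    · rw [hXP]; abel
    · rw [lie_sub, ← hα.apply_XQ, ← hβ.apply_XQ, hXQ]; abel
  rw [sub_eq_zero] at h0
  refine F.twoCochain_ext h0 ?_ ?_
  · rw [hα.apply_XQ, hβ.apply_XQ, h0]
  · rw [h, add_apply_apply, F.d₁₂_PQ hs, add_zero]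

/-- Each cocycle is cohomologous to a harmonic one. -/
theorem exists_isHarmonic_add [FiniteDimensional ℝ a] (hs : SemisimpleModule l a)
    {M : OrthModule θ a} {α : twoCochain ℝ l a} {γ : ThreeForm l} (h : IsCocycle M α γ) :
    ∃ τ : l →ₗ[ℝ] a, (∀ x, M.theta (τ (θ.toHom x)) = τ x) ∧
      F.IsHarmonic M (α + d₁₂ ℝ l a τ) := by
  obtain ⟨h1, h2, h3, h4⟩ := (F.isCocycle_iff hs M α γ).1 h
  -- A coboundary changes α(X,Q) + ρ(X)α(X,P) by f(y), so only its component v in ker f persists; w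
  -- determines y.
  obtain ⟨v, w, hvw, hv, hv', hw⟩ := F.exists_add_opf_minus hs M
    (A := α F.X F.Q + ⁅F.X, α F.X F.P⁆) (by rw [map_add, h4, F.theta_lie_X, h3]; abel)
  have hXX : ⁅F.X, ⁅F.X, v⁆⁆ = F.ε • v := by rwa [opf_apply, sub_eq_zero] at hv
  -- The new value at X, P: a harmonic pair (u, ρ(X)u) has invariant 2ρ(X)u, so ρ(X)u = v/2 is
  -- required.
  set u : a := (1 / (2 * F.ε)) • ⁅F.X, v⁆ with hu
  have hXu : ⁅F.X, u⁆ = (1 / 2 : ℝ) • v := by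
    rw [hu, lie_smul, hXX, smul_smul]
    congr 1
    field_simp [F.ε_ne]
  have hXXw : ⁅F.X, ⁅F.X, w⁆⁆ = F.opf a w + F.ε • w := by rw [opf_apply, sub_add_cancel]
  -- Solves α(X,P) + ρ(X)(-w) - z = u.
  set z : a := α F.X F.P - ⁅F.X, w⁆ - u with hz
  have hθu : M.theta u = u := by
    rw [hu, map_smul, F.theta_lie_X, hv', lie_neg, neg_neg]
  have hθz : M.theta z = z := by
    rw [hz, map_sub, map_sub, h3, hθu, F.theta_lie_X, hw, lie_neg, neg_neg]
  have eXP : (α + d₁₂ ℝ l a (F.oneCochain 0 (-w) z)) F.X F.P = u := by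
    rw [add_apply_apply, F.d₁₂_XP hs, F.oneCochain_P, F.oneCochain_Q, hz, lie_neg]
    abel
  have ePQ : (α + d₁₂ ℝ l a (F.oneCochain 0 (-w) z)) F.P F.Q = α F.P F.Q := by
    rw [add_apply_apply, F.d₁₂_PQ hs, add_zero]
  refine ⟨F.oneCochain 0 (-w) z, F.theta_oneCochain M (by simp) (by rw [map_neg, hw]) hθz,
    ?_, ?_, ?_, ?_, ?_⟩
  · rw [ePQ]; exact h1
  · rw [ePQ]; exact h2
  · rw [eXP]; exact hθu
  · rw [eXP, hu, map_smul, ← F.lie_opf, hv, lie_zero, smul_zero]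
  · rw [eXP, add_apply_apply, F.d₁₂_XQ hs, F.oneCochain_P, F.oneCochain_Q, hz, lie_sub, lie_sub,
      hXXw, hXu]
    have h5 : α F.X F.Q = v + F.opf a w - ⁅F.X, α F.X F.P⁆ := by rw [← hvw, add_sub_cancel_right]
    rw [h5]
    module

/-- A non-zero harmonic cochain pairs non-trivially with the closed 1-cochains. -/
theorem exists_wedgeTwoOne_eq [FiniteDimensional ℝ a] (hs : SemisimpleModule l a)
    {M : OrthModule θ a} {α : twoCochain ℝ l a} (hα : F.IsHarmonic M α) (h0 : α ≠ 0) (r : ℝ) :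
    ∃ τ : l →ₗ[ℝ] a, (∀ x, M.theta (τ (θ.toHom x)) = τ x) ∧ d₁₂ ℝ l a τ = 0 ∧
      wedgeTwoOne M α τ F.X F.P F.Q = r := by
  have hz : ∀ x y : l, (0 : twoCochain ℝ l a) x y = 0 := fun _ _ => rfl
  have hminus : ∀ A : a, M.theta A = -A → A ≠ 0 → ∃ B, M.theta B = -B ∧ M.form A B = 1 := by
    intro A hA hA0
    by_contra hc
    push Not at hc
    refine hA0 (M.eq_zero_of_form_left fun B => ?_)
    by_contra hB
    -- Antisymmetrise B under θ: since θA = -A, the pairing of A with B - θB is 2⟨A,B⟩.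
    refine hc ((1 / (2 * M.form A B)) • (B - M.theta B)) ?_ ?_
    · rw [map_smul, map_sub, M.theta_invol]; module
    · rw [map_smul, map_sub, ← M.form_theta_left, hA, map_neg, LinearMap.neg_apply, smul_eq_mul]
      field_simp
      ring
  by_cases hPQ : α F.P F.Q = 0
  · have hXQ : α F.X F.Q ≠ 0 := by
      intro h
      have hXP : α F.X F.P = 0 := by
        have := hα.lie_XQ
        rw [h, lie_zero] at this
        exact (smul_eq_zero.1 this.symm).resolve_left F.ε_ne
      exact h0 (F.twoCochain_ext (by rw [hXP, hz]) (by rw [h, hz]) (by rw [hPQ, hz]))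
    obtain ⟨B, hB, hAB⟩ := hminus _ hα.theta_XQ hXQ
    -- Only the part of B in ker f pairs with α(X,Q), and on ker f the cochain with values y, ρ(X)y
    -- at P, Q is closed.
    obtain ⟨y, w, hyw, hy, hy', -⟩ := F.exists_add_opf_minus hs M hB
    have hXQy : M.form (α F.X F.Q) y = 1 := by
      rw [hyw, map_add, ← F.form_opf, hα.apply_XQ, ← F.lie_opf, hα.opf_XP, lie_zero, map_zero,
        LinearMap.zero_apply, add_zero, ← hα.apply_XQ] at hAB
      exact hAB
    have hXX : ⁅F.X, ⁅F.X, y⁆⁆ = F.ε • y := by rwa [opf_apply, sub_eq_zero] at hy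
    -- By skewness the terms ⟨α(X,P), τ(Q)⟩ and -⟨α(X,Q), τ(P)⟩ contribute r/2 each.
    refine ⟨F.oneCochain 0 ((-r / 2) • y) ((-r / 2) • ⁅F.X, y⁆), F.theta_oneCochain M (by simp)
      (by rw [map_smul, hy', smul_neg])
      (by rw [map_smul, F.theta_lie_X, hy', lie_neg, neg_neg]), F.twoCochain_ext ?_ ?_ ?_, ?_⟩
    · rw [F.d₁₂_XP hs, F.oneCochain_P, F.oneCochain_Q, lie_smul, sub_self, hz]
    · rw [F.d₁₂_XQ hs, F.oneCochain_P, F.oneCochain_Q, lie_smul, hXX, smul_comm, sub_self, hz]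
    · rw [F.d₁₂_PQ hs, hz]
    · rw [wedgeTwoOne, F.oneCochain_X, F.oneCochain_P, F.oneCochain_Q, map_zero, map_smul,
        map_smul, skew_right M, M.symm y, ← hα.apply_XQ, hXQy, smul_eq_mul, smul_eq_mul]
      ring
  · obtain ⟨B, hB, hAB⟩ := hminus _ hα.theta_PQ hPQ
    -- The value of τ at X does not enter dτ, because P and Q act by zero.
    refine ⟨F.oneCochain (r • B) 0 0, F.theta_oneCochain M (by rw [map_smul, hB, smul_neg])
      (by simp) (by simp), F.twoCochain_ext ?_ ?_ ?_, ?_⟩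
    · rw [F.d₁₂_XP hs, F.oneCochain_P, F.oneCochain_Q, lie_zero, sub_self, hz]
    · rw [F.d₁₂_XQ hs, F.oneCochain_P, F.oneCochain_Q, lie_zero, smul_zero, sub_self, hz]
    · rw [F.d₁₂_PQ hs, hz]
    · rw [wedgeTwoOne, F.oneCochain_X, F.oneCochain_P, F.oneCochain_Q, map_zero, map_smul, hAB,
        map_zero, smul_eq_mul]
      ring

/-- The classification of the quadratic cohomology classes. -/
theorem bijective_elim [FiniteDimensional ℝ a] (hs : SemisimpleModule l a) (M : OrthModule θ a)
    (S : Submodule ℝ (twoCochain ℝ l a)) (hS : ∀ α, α ∈ S ↔ F.IsHarmonic M α)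
    (hZ : ∀ α ∈ S, IsCocycle M α 0) (hC : ∀ γ : ThreeForm l, IsCocycle M 0 γ) :
    Function.Bijective (Sum.elim
      (fun α : {α : twoCochain ℝ l a // α ∈ S ∧ α ≠ 0} => HQ.mk M α.1 0 (hZ α.1 α.2.1))
      (fun γ : ThreeForm l => HQ.mk M 0 γ (hC γ))) := by
  have hrel : ∀ {α β : twoCochain ℝ l a} {γ δ : ThreeForm l} (h : IsCocycle M α γ)
      (h' : IsCocycle M β δ), α ∈ S → β ∈ S → HQ.mk M α γ h = HQ.mk M β δ h' → β = α := by
    intro α β γ δ h h' hα hβ e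
    rw [F.mk_eq_mk_iff] at e
    obtain ⟨τ, -, h1, -⟩ := e
    exact ((hS α).1 hα).eq_of_eq_add_d₁₂ hs ((hS β).1 hβ) h1
  constructor
  · rintro (⟨α, hα, hα0⟩ | γ) (⟨β, hβ, hβ0⟩ | δ) e
    · have := hrel _ _ hα hβ e
      subst this
      rfl
    · exact absurd (hrel _ _ hα S.zero_mem e).symm hα0
    · exact absurd (hrel _ _ S.zero_mem hβ e) hβ0
    · have e' : HQ.mk M 0 γ (hC γ) = HQ.mk M 0 δ (hC δ) := e
      rw [F.mk_eq_mk_iff] at e'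
      obtain ⟨τ, -, h1, h2⟩ := e'
      -- A cochain τ relating α = 0 to itself is closed, so γ is not moved.
      have h3 : d₁₂ ℝ l a τ = 0 := by
        have : (0 : twoCochain ℝ l a) = 0 + d₁₂ ℝ l a τ := h1
        rw [zero_add] at this
        exact this.symm
      have h4 : wedgeTwoOne M ((0 : twoCochain ℝ l a) + (1 / 2 : ℝ) • d₁₂ ℝ l a τ) τ
          F.X F.P F.Q = 0 := by
        have hz : ∀ x y : l, (0 : twoCochain ℝ l a) x y = 0 := fun _ _ => rfl
        rw [h3, smul_zero, add_zero]
        simp [wedgeTwoOne, hz]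
      rw [h4, add_zero] at h2
      rw [F.threeForm_ext h2]
  · intro φ
    induction φ using Quotient.ind with
    | _ c =>
      obtain ⟨⟨α, γ⟩, h⟩ := c
      obtain ⟨τ, hτ, hβ⟩ := F.exists_isHarmonic_add hs h
      set β := α + d₁₂ ℝ l a τ with hβd
      set δ := F.threeForm (γ ![F.X, F.P, F.Q]
        + wedgeTwoOne M (α + (1 / 2 : ℝ) • d₁₂ ℝ l a τ) τ F.X F.P F.Q) with hδ
      have e1 : HQ.mk M α γ h = HQ.mk M β δ (hβ.isCocycle hs δ) := by
        rw [F.mk_eq_mk_iff]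
        refine ⟨τ, hτ, rfl, ?_⟩
        show δ ![F.X, F.P, F.Q] = _
        rw [hδ, F.threeForm_apply, F.vol_XPQ, mul_one]
      by_cases h0 : β = 0
      · refine ⟨Sum.inr δ, ?_⟩
        show HQ.mk M 0 δ (hC δ) = HQ.mk M α γ h
        rw [e1]
        congr 1
        exact h0.symm
      · refine ⟨Sum.inl ⟨β, (hS β).2 hβ, h0⟩, ?_⟩
        show HQ.mk M β 0 _ = HQ.mk M α γ h
        rw [e1, eq_comm, F.mk_eq_mk_iff]
        -- A closed τ' leaves β fixed and can be chosen to cancel δ.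
        obtain ⟨τ', hτ', hd, hw⟩ := F.exists_wedgeTwoOne_eq hs hβ h0 (-δ ![F.X, F.P, F.Q])
        refine ⟨τ', hτ', ?_, ?_⟩
        · rw [hd, add_zero]
        · show (0 : ThreeForm l) _ = δ _ + wedgeTwoOne M (β + _) τ' _ _ _
          rw [hd, smul_zero, add_zero, hw, add_neg_cancel]
          rfl

end Frame

/-! ### Splitting off a trivial module -/

/-- The orthogonal module structure on a non-degenerate, `θ`-stable submodule. -/
def OrthModule.restrict (M : OrthModule θ a) (N : LieSubmodule ℝ l a)
    (hN : M.NondegOn N.toSubmodule) (hθ : ∀ A ∈ N, M.theta A ∈ N) : OrthModule θ N where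
  form := M.form.restrict N.toSubmodule
  symm A B := M.symm A B
  nondeg := hN
  skew L A B := M.skew L A B
  theta := M.theta.restrict hθ
  theta_invol A := Subtype.ext (M.theta_invol A)
  theta_isom A B := M.theta_isom A B
  compat L A := Subtype.ext (M.compat L A)

/-- The trivial action. -/
@[reducible] def trivialLieRingModule (l' : Type*) [LieRing l'] (V : Type*) [AddCommGroup V] :
    LieRingModule l' V where
  bracket _ _ := 0
  add_lie _ _ _ := (add_zero 0).symm
  lie_add _ _ _ := (add_zero 0).symm
  leibniz_lie _ _ _ := (add_zero 0).symm

theorem trivialLieModule (l' : Type*) [LieRing l'] [LieAlgebra ℝ l'] (V : Type*) [AddCommGroup V]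
    [Module ℝ V] : letI := trivialLieRingModule l' V; LieModule ℝ l' V :=
  letI := trivialLieRingModule l' V
  { smul_lie := fun t _ _ => (smul_zero t).symm
    lie_smul := fun t _ _ => (smul_zero t).symm }

/-- The trivial orthogonal module structure on a non-degenerate, `θ`-stable subspace. -/
def OrthModule.restrictTrivial (M : OrthModule θ a) (V : Submodule ℝ a)
    (hV : M.NondegOn V) (hθ : ∀ A ∈ V, M.theta A ∈ V)
    {l' : Type*} [LieRing l'] [LieAlgebra ℝ l'] (θ' : LieInvolution l') :
    letI := trivialLieRingModule l' V
    haveI := trivialLieModule l' V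
    OrthModule θ' V :=
  letI := trivialLieRingModule l' V
  haveI := trivialLieModule l' V
  { form := M.form.restrict V
    symm := fun A B => M.symm A B
    nondeg := hV
    skew := fun L A B => by
      show M.form 0 B + M.form A 0 = 0
      simp
    theta := M.theta.restrict hθ
    theta_invol := fun A => Subtype.ext (M.theta_invol A)
    theta_isom := fun A B => M.theta_isom A B
    compat := fun L A => map_zero _ }

theorem isCocycle_zero (M : OrthModule θ a) : IsCocycle M 0 0 := by
  have hz : ∀ x y : l, (0 : twoCochain ℝ l a) x y = 0 := fun _ _ => rfl
  exact ⟨map_zero _, by simp [dThree, wedgeTwoTwo, hz], by simp [hz], by simp⟩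

/-- A 2-cochain with values in a submodule. -/
def codRestrict (N : LieSubmodule ℝ l a) (α : twoCochain ℝ l a) (h : ∀ x y, α x y ∈ N) :
    twoCochain ℝ l N :=
  ⟨LinearMap.mk₂ ℝ (fun x y => (⟨α x y, h x y⟩ : N))
    (fun x y z => Subtype.ext (by simp)) (fun r x y => Subtype.ext (by simp))
    (fun x y z => Subtype.ext (by simp)) (fun r x y => Subtype.ext (by simp)),
    fun x => Subtype.ext (twoCochain_alt α x)⟩

theorem isCocycle_codRestrict {M : OrthModule θ a} {N : LieSubmodule ℝ l a}
    {hN : M.NondegOn N.toSubmodule} {hθ : ∀ A ∈ N, M.theta A ∈ N} {α : twoCochain ℝ l a}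
    {γ : ThreeForm l} (hα : IsCocycle M α γ) (h : ∀ x y, α x y ∈ N) :
    IsCocycle (M.restrict N hN hθ) (codRestrict N α h) γ where
  closed := by
    ext x y z
    have := congrArg (fun f => f x y z) hα.closed
    exact this
  quad := hα.quad
  inv_left x y := Subtype.ext (hα.inv_left x y)
  inv_right := hα.inv_right

/-- If `a` contains a non-zero non-degenerate trivial submodule orthogonal to the values of `α`,
then `[α, γ]` is decomposable. -/
theorem isDecomposable_of_orthogonal [FiniteDimensional ℝ l] [Nontrivial l]
    [FiniteDimensional ℝ a] {M : OrthModule θ a} {V : Submodule ℝ a} (hV0 : V ≠ ⊥)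
    (hV : M.NondegOn V) (hinv : V ≤ M.inv) (hθ : ∀ A ∈ V, M.theta A ∈ V)
    {α : twoCochain ℝ l a} {γ : ThreeForm l} (h : IsCocycle M α γ)
    (hα : ∀ x y, ∀ A ∈ V, M.form A (α x y) = 0) : IsDecomposable M (HQ.mk M α γ h) := by
  have hc : IsCompl V (M.form.orthogonal V) :=
    LinearMap.BilinForm.isCompl_orthogonal_of_restrict_nondegenerate M.form_isRefl hV
  let W : LieSubmodule ℝ l a :=
    { M.form.orthogonal V with
      lie_mem := fun {L A} _ B hB => by
        show M.form B ⁅L, A⁆ = 0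
        rw [skew_right M, hinv hB L, map_zero, neg_zero] }
  have hW : ∀ A, A ∈ W ↔ ∀ B ∈ V, M.form B A = 0 := fun A => Iff.rfl
  have hWθ : ∀ A ∈ W, M.theta A ∈ W := fun A hA B hB => by
    show M.form B (M.theta A) = 0
    rw [← M.form_theta_left]
    exact hA _ (hθ B hB)
  have hdec : ∀ A, ∃ B ∈ W, ∃ C ∈ V, B + C = A := fun A => by
    have : A ∈ V ⊔ M.form.orthogonal V := by rw [hc.sup_eq_top]; trivial
    obtain ⟨C, hC, B, hB, rfl⟩ := Submodule.mem_sup.1 this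
    exact ⟨B, hB, C, hC, add_comm _ _⟩
  have hWn : M.NondegOn W.toSubmodule := by
    rw [M.nondegOn_iff]
    intro A hA hAW
    refine M.eq_zero_of_form_left fun D => ?_
    obtain ⟨B, hB, C, hC, rfl⟩ := hdec D
    rw [map_add, hAW B hB, M.symm, hA C hC, add_zero]
  -- The decomposition is (l, V^⊥) ⊕ (0, V), the cocycle living on the first summand. The zero Lie
  -- algebra is realised as the zero ideal, which keeps it in the universe of l.
  let l₂ := (⊥ : LieIdeal ℝ l)
  let θ₂ : LieInvolution l₂ := ⟨LieHom.id, fun _ => rfl⟩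
  let _ : LieRingModule l₂ V := trivialLieRingModule l₂ V
  have _ : LieModule ℝ l₂ V := trivialLieModule l₂ V
  let M₁ := M.restrict W hWn hWθ
  let M₂ : OrthModule θ₂ V := M.restrictTrivial V hV hθ θ₂
  let f₁ : TripleHom M M₁ :=
    { S := LieHom.id
      U := W.toSubmodule.subtype
      isom := fun A B => rfl
      equivariant := fun L A => rfl
      S_theta := fun x => rfl
      U_theta := fun A => rfl }
  let f₂ : TripleHom M M₂ :=
    { S := 0
      U := V.subtype
      isom := fun A B => rfl
      equivariant := fun L A => (hinv A.2 L).symm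
      S_theta := fun x => rfl
      U_theta := fun A => rfl }
  refine ⟨l, inferInstance, inferInstance, inferInstance, θ, W, inferInstance, inferInstance,
    inferInstance, inferInstance, inferInstance, M₁, l₂, inferInstance, inferInstance,
    inferInstance, θ₂, V, inferInstance, inferInstance, inferInstance, inferInstance,
    inferInstance, M₂, f₁, f₂, ⟨?_, ?_, ?_, ?_, ?_⟩, ⟨(α, γ), h⟩,
    ⟨(codRestrict W α fun x y => hα x y, γ), isCocycle_codRestrict h _⟩,
    ⟨(0, 0), isCocycle_zero M₂⟩, rfl, fun x y => ?_, fun x y z => ?_⟩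
  · rintro ⟨h1, -⟩
    obtain ⟨x, hx⟩ := exists_ne (0 : l)
    exact hx (congrArg (fun f : l →ₗ⁅ℝ⁆ l => f x) h1)
  · rintro ⟨-, h1⟩
    refine hV0 (eq_bot_iff.2 fun A hA => ?_)
    exact congrArg (fun f : V →ₗ[ℝ] a => f ⟨A, hA⟩) h1
  · refine ⟨fun x y hxy => congrArg Prod.fst hxy, fun p => ⟨p.1, Prod.ext rfl ?_⟩⟩
    exact Subsingleton.elim (α := (⊥ : LieIdeal ℝ l)) _ _
  · constructor
    · rintro ⟨B, C⟩ ⟨B', C'⟩ hBC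
      have e : (B : a) + C = B' + C' := hBC
      have hBB : (B : a) - B' = C' - C := by
        rw [sub_eq_sub_iff_add_eq_add, e, add_comm]
      have hmem : (C' : a) - C ∈ V ⊓ M.form.orthogonal V :=
        ⟨V.sub_mem C'.2 C.2, by rw [← hBB]; exact W.toSubmodule.sub_mem B.2 B'.2⟩
      rw [hc.inf_eq_bot, Submodule.mem_bot] at hmem
      rw [hmem] at hBB
      exact Prod.ext (Subtype.ext (sub_eq_zero.1 hBB)) (Subtype.ext (sub_eq_zero.1 hmem).symm)
    · intro A
      obtain ⟨B, hB, C, hC, e⟩ := hdec A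
      exact ⟨(⟨B, hB⟩, ⟨C, hC⟩), e⟩
  · intro A B
    show M.form A B = 0
    rw [M.symm]
    exact A.2 B B.2
  · exact (add_zero _).symm
  · exact (add_zero _).symm

/-! ### Indecomposability of the Lie algebra -/

namespace Frame

variable (F : Frame θ)

/-- The Lie algebra of a frame is not a direct product of two non-zero Lie algebras. -/
theorem eq_zero_or_eq_zero_of_bijective {l₁ l₂ : Type*} [LieRing l₁] [LieAlgebra ℝ l₁]
    [LieRing l₂] [LieAlgebra ℝ l₂] (F : Frame θ) (f : l →ₗ⁅ℝ⁆ l₁) (g : l →ₗ⁅ℝ⁆ l₂)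
    (h : Function.Bijective fun x : l => (f x, g x)) : f = 0 ∨ g = 0 := by
  have hinj : ∀ x, f x = 0 → g x = 0 → x = 0 := fun x hf hg =>
    h.1 (Prod.ext (by simp [hf]) (by simp [hg]))
  have hcomm : ∀ x y, f x = 0 → g y = 0 → ⁅x, y⁆ = 0 := fun x y hf hg =>
    hinj _ (by rw [LieHom.map_lie, hf, zero_lie]) (by rw [LieHom.map_lie, hg, lie_zero])
  -- The second condition kills the X-coordinate of y; then [x,y] = 0 kills the other two.
  have hcent : ∀ x y : l, F.b.coord 0 x ≠ 0 → ⁅x, y⁆ = 0 → ⁅x, ⁅F.P, y⁆⁆ = 0 → y = 0 := by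
    intro x y hx h1 h2
    have h3 := congrArg (F.b.coord 1) h2
    rw [F.coord_one_lie, F.coord_two_lie, F.coord_zero_lie] at h3
    simp only [F.coord_P, map_zero, mul_zero, zero_mul, zero_sub, one_mul, sub_zero, mul_neg,
      neg_eq_zero, mul_eq_zero, F.ε_ne, hx, false_or] at h3
    have h4 := congrArg (F.b.coord 1) h1
    have h5 := congrArg (F.b.coord 2) h1
    rw [F.coord_one_lie] at h4
    rw [F.coord_two_lie] at h5
    simp only [h3, map_zero, mul_zero, sub_zero, mul_eq_zero, F.ε_ne, hx, false_or] at h4 h5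
    exact F.ext_coord (by simp [h3]) (by simp [h5]) (by simp [h4])
  -- Write X = x + y with x in ker g and y in ker f. If x has non-zero X-coordinate, the ideal ker
  -- f, which commutes with x, is zero by `hcent`; then g = 0. Otherwise y plays this role.
  obtain ⟨x, hx⟩ := h.2 (f F.X, 0)
  obtain ⟨y, hy⟩ := h.2 (0, g F.X)
  obtain ⟨hx1, hx2⟩ := Prod.mk.inj hx
  obtain ⟨hy1, hy2⟩ := Prod.mk.inj hy
  have hxy : x + y = F.X := h.1 (Prod.ext (by simp [hx1, hy1]) (by simp [hx2, hy2]))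
  have hco : F.b.coord 0 x ≠ 0 ∨ F.b.coord 0 y ≠ 0 := by
    by_contra hc
    push Not at hc
    have := congrArg (F.b.coord 0) hxy
    rw [map_add, hc.1, hc.2, F.coord_X.1, add_zero] at this
    exact zero_ne_one this
  rcases hco with hx0 | hy0
  · right
    have hker : ∀ z, f z = 0 → z = 0 := fun z hz => by
      refine hcent x z hx0 ?_ ?_
      · rw [← lie_skew, hcomm z x hz hx2, neg_zero]
      · rw [← lie_skew, hcomm _ x (by rw [LieHom.map_lie, hz, lie_zero]) hx2, neg_zero]
    ext z
    obtain ⟨w, hw⟩ := h.2 (0, g z)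
    obtain ⟨hw1, hw2⟩ := Prod.mk.inj hw
    rw [← hw2, hker w hw1, map_zero, LieHom.zero_apply]
  · left
    have hker : ∀ z, g z = 0 → z = 0 := fun z hz =>
      hcent y z hy0 (hcomm y z hy1 hz)
        (hcomm y _ hy1 (by rw [LieHom.map_lie, hz, lie_zero]))
    ext z
    obtain ⟨w, hw⟩ := h.2 (f z, 0)
    obtain ⟨hw1, hw2⟩ := Prod.mk.inj hw
    rw [← hw1, hker w hw2, map_zero, LieHom.zero_apply]

/-- A decomposable class splits off a trivial module. -/
theorem exists_orthogonal_of_isDecomposable (F : Frame θ) {M : OrthModule θ a} {φ : HQ M}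
    (h : IsDecomposable M φ) : ∃ A ∈ M.inv, A ≠ 0 ∧ ∃ (α : twoCochain ℝ l a) (γ : ThreeForm l)
      (h : IsCocycle M α γ), φ = HQ.mk M α γ h ∧ ∀ x y, M.form A (α x y) = 0 := by
  obtain ⟨l₁, _, _, _, θ₁, a₁, _, _, _, _, _, M₁, l₂, _, _, _, θ₂, a₂, _, _, _, _, _, M₂, f₁, f₂,
    hd, ⟨⟨α, γ⟩, hc⟩, c₁, c₂, hφ, hα, -⟩ := h
  have hα' : ∀ x y, α x y
      = f₁.U (c₁.1.1 (f₁.S x) (f₁.S y)) + f₂.U (c₂.1.1 (f₂.S x) (f₂.S y)) := hα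
  -- If qᵢ = 0 then jᵢ ≠ 0; equivariance makes im jᵢ invariant, and α takes its values in the
  -- orthogonal image of the other summand.
  rcases F.eq_zero_or_eq_zero_of_bijective f₁.S f₂.S hd.bijective_l with h0 | h0
  · have hU : ¬ f₁.U = 0 := fun h => hd.ne_zero₁ ⟨h0, h⟩
    obtain ⟨B, hB⟩ : ∃ B, f₁.U B ≠ 0 := by
      by_contra hc
      push Not at hc
      exact hU (LinearMap.ext hc)
    refine ⟨f₁.U B, fun L => ?_, hB, α, γ, hc, hφ, fun x y => ?_⟩
    · rw [← f₁.equivariant, h0, LieHom.zero_apply, zero_lie, map_zero]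
    · rw [hα', h0, map_add, hd.orthogonal]
      simp
  · have hU : ¬ f₂.U = 0 := fun h => hd.ne_zero₂ ⟨h0, h⟩
    obtain ⟨B, hB⟩ : ∃ B, f₂.U B ≠ 0 := by
      by_contra hc
      push Not at hc
      exact hU (LinearMap.ext hc)
    refine ⟨f₂.U B, fun L => ?_, hB, α, γ, hc, hφ, fun x y => ?_⟩
    · rw [← f₂.equivariant, h0, LieHom.zero_apply, zero_lie, map_zero]
    · rw [hα', h0, map_add, M.symm, hd.orthogonal]
      simp

end Frame

-- On the kernel of the bracket α may be replaced by α - g ∘ [·,·].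
omit [LieRingModule l a] [LieModule ℝ l a] in
theorem kerImage_le {α : twoCochain ℝ l a} {V : Submodule ℝ l} {N : Submodule ℝ a}
    (g : l →ₗ[ℝ] a) (h : ∀ x ∈ V, ∀ y ∈ V, α x y - g ⁅x, y⁆ ∈ N) : kerImage α V ≤ N := by
  rintro _ ⟨t, ht, rfl⟩
  have key : ∀ t : V ⊗[ℝ] V, TensorProduct.lift (α.1.domRestrict₁₂ V V) t
      - g (TensorProduct.lift
        (((LieModule.toEnd ℝ l l : l →ₗ[ℝ] (l →ₗ[ℝ] l))).domRestrict₁₂ V V) t) ∈ N := by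
    intro t
    induction t with
    | zero => simp
    | tmul x y => exact h x x.2 y y.2
    | add s t hs ht =>
      rw [map_add, map_add, map_add, add_sub_add_comm]
      exact N.add_mem hs ht
  have h1 := key t
  rw [LinearMap.mem_ker.1 ht, map_zero, sub_zero] at h1
  exact h1

omit [LieRingModule l a] [LieModule ℝ l a] in
theorem apply_mem_kerImage {α : twoCochain ℝ l a} {V : Submodule ℝ l} {x y : l} (hx : x ∈ V)
    (hy : y ∈ V) (h : ⁅x, y⁆ = 0) : α x y ∈ kerImage α V :=
  ⟨(⟨x, hx⟩ : V) ⊗ₜ[ℝ] (⟨y, hy⟩ : V), h, rfl⟩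

namespace Frame

variable (F : Frame θ)

/-! ### The admissibility conditions -/

-- ⋀²l₋ is the line through X ∧ P, and [X,P] = Q ≠ 0. Accordingly g sends Q to α(X,P).
omit [LieRingModule l a] [LieModule ℝ l a] in
theorem kerImage_minus (F : Frame θ) (α : twoCochain ℝ l a) : kerImage α θ.minus = ⊥ := by
  rw [eq_bot_iff]
  refine kerImage_le ((F.b.coord 2).smulRight (α F.X F.P)) fun x hx y hy => ?_
  rw [F.mem_minus] at hx hy
  rw [F.twoCochain_eq α x y, LinearMap.smulRight_apply, F.coord_two_lie, hx, hy]
  simp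

theorem condT₂_iff (F : Frame θ) (hs : SemisimpleModule l a) {M : OrthModule θ a}
    {α : twoCochain ℝ l a} : CondT₂ M α ↔ M.inv ⊓ M.plus = ⊥ := by
  have h : invKerImage M α θ.minus = ⊥ := by
    rw [invKerImage, F.kerImage_minus, bot_sup_eq, eq_bot_iff]
    exact fun A hA => M.eq_zero_of_mem_inv_of_mem_moved hs hA.2 hA.1
  rw [CondT₂, h]

/-- The orthogonal complement of the values of a harmonic cochain. -/
noncomputable def orth [FiniteDimensional ℝ a] (hs : SemisimpleModule l a) {M : OrthModule θ a}
    {α : twoCochain ℝ l a} (hα : F.IsHarmonic M α) : LieSubmodule ℝ l a :=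
  F.submodule hs (LinearMap.ker (M.form (α F.P F.Q)) ⊓ (LinearMap.ker (M.form (α F.X F.P)) ⊓
      LinearMap.ker (M.form (α F.X F.Q)))) (by
    rintro B ⟨-, h2, h3⟩
    have h2' : M.form (α F.X F.P) B = 0 := h2
    have h3' : M.form (α F.X F.Q) B = 0 := h3
    refine ⟨?_, ?_, ?_⟩
    · show M.form (α F.P F.Q) ⁅F.X, B⁆ = 0
      rw [skew_right, hα.mem_inv F.X, map_zero, neg_zero]
    · show M.form (α F.X F.P) ⁅F.X, B⁆ = 0
      rw [skew_right, ← hα.apply_XQ, M.symm, h3', neg_zero]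
    · show M.form (α F.X F.Q) ⁅F.X, B⁆ = 0
      rw [skew_right, hα.lie_XQ, map_smul, M.symm, h2', smul_zero, neg_zero])

theorem mem_orth [FiniteDimensional ℝ a] (hs : SemisimpleModule l a) {M : OrthModule θ a}
    {α : twoCochain ℝ l a} (hα : F.IsHarmonic M α) {B : a} : B ∈ F.orth hs hα ↔
      M.form (α F.P F.Q) B = 0 ∧ M.form (α F.X F.P) B = 0 ∧ M.form (α F.X F.Q) B = 0 := Iff.rfl

/-- On the orthogonal complement Φ = 0 works. Conversely, a solution on b says that α is a
coboundary when tested against b, and the argument of `eq_zero_of_coboundary`, run weakly, forces b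
to be orthogonal to the values of α. -/
theorem isGreatest_orth [FiniteDimensional ℝ a] (hs : SemisimpleModule l a) {M : OrthModule θ a}
    {α : twoCochain ℝ l a} (hα : F.IsHarmonic M α) :
    IsGreatest {b | SolvableOn M α 1 b} (F.orth hs hα) := by
  constructor
  · refine ⟨0, fun L K B hB => ?_⟩
    obtain ⟨h1, h2, h3⟩ := (F.mem_orth hs hα).1 hB
    rw [F.twoCochain_eq α]
    simp [h1, h2, h3]
  · rintro b ⟨Φ, hΦ⟩ B hB
    have hP : F.P ∈ Rad l 1 := by rw [F.rad_one]; exact F.P_mem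
    have hQ : F.Q ∈ Rad l 1 := by rw [F.rad_one]; exact F.Q_mem
    have eXP : (⁅F.X, (⟨F.P, hP⟩ : Rad l 1)⁆ : Rad l 1) = ⟨F.Q, hQ⟩ := Subtype.ext F.lie_XP
    have eXQ : (⁅F.X, (⟨F.Q, hQ⟩ : Rad l 1)⁆ : Rad l 1) = F.ε • ⟨F.P, hP⟩ := Subtype.ext F.lie_XQ
    have ePQ : (⁅F.P, (⟨F.Q, hQ⟩ : Rad l 1)⁆ : Rad l 1) = 0 := Subtype.ext F.lie_PQ
    set y := Φ ⟨F.P, hP⟩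
    set z := Φ ⟨F.Q, hQ⟩
    have h1 : ∀ C ∈ b, M.form (α F.X F.P) C = M.form (⁅F.X, y⁆ - z) C := fun C hC => by
      have := hΦ F.X ⟨F.P, hP⟩ C hC
      rwa [eXP] at this
    have h2 : ∀ C ∈ b, M.form (α F.X F.Q) C = M.form (⁅F.X, z⁆ - F.ε • y) C := fun C hC => by
      have := hΦ F.X ⟨F.Q, hQ⟩ C hC
      rwa [eXQ, map_smul] at this
    have h3 : M.form (α F.P F.Q) B = 0 := by
      have := hΦ F.P ⟨F.Q, hQ⟩ B hB
      rw [ePQ, map_zero, sub_zero, (F.lie_P_eq_zero_and_lie_Q_eq_zero hs _).1, map_zero,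
        LinearMap.zero_apply] at this
      exact this
    -- Weak form of f(y) = 2ρ(X)u: test the first equation against ρ(X)C and the second against C to
    -- eliminate z.
    have h4 : ∀ C ∈ b, (2 : ℝ) * M.form (α F.X F.Q) C = M.form (F.opf a y) C := fun C hC => by
      have e1 := h1 ⁅F.X, C⁆ (b.lie_mem hC)
      have e2 := h2 C hC
      rw [← neg_inj, ← skew_left, ← skew_left, ← hα.apply_XQ, lie_sub] at e1
      rw [opf_apply]
      simp only [map_sub, LinearMap.sub_apply] at e1 e2 ⊢
      linarith
    -- Split C inside b: ⟨f(y), ·⟩ vanishes on ker f, and ⟨α(X,Q), ·⟩ vanishes on im f.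
    have h5 : ∀ C ∈ b, M.form (α F.X F.Q) C = 0 := fun C hC => by
      obtain ⟨C₀, hC₀, C₁, -, rfl, h0⟩ := F.exists_add_opf hs b hC
      have e1 := h4 C₀ hC₀
      rw [F.form_opf, h0, map_zero] at e1
      rw [map_add, ← F.form_opf, hα.apply_XQ, ← F.lie_opf, hα.opf_XP, lie_zero, map_zero,
        LinearMap.zero_apply, add_zero, ← hα.apply_XQ]
      linarith
    refine (F.mem_orth hs hα).2 ⟨h3, ?_, h5 B hB⟩
    have e := h5 ⁅F.X, B⁆ (b.lie_mem hB)
    rw [← neg_eq_zero, ← skew_left, hα.lie_XQ, map_smul, LinearMap.smul_apply, smul_eq_mul] at e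
    exact (mul_eq_zero.1 e).resolve_left F.ε_ne

/-- A non-zero K in an ideal as in (A₁), together with [X,K], exhibits α as a coboundary in the
direction of K; harmonicity then gives α = 0, and a symmetry argument gives γ = 0. -/
theorem condA_one [FiniteDimensional ℝ a] (hs : SemisimpleModule l a) {M : OrthModule θ a}
    {α : twoCochain ℝ l a} (hα : F.IsHarmonic M α) {γ : ThreeForm l} (h : α = 0 → γ ≠ 0) :
    CondA M α γ 1 := by
  rintro I hI ⟨Φ₁, Φ₂, hΦ⟩
  have hP : F.P ∈ Rad l 1 := by rw [F.rad_one]; exact F.P_mem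
  have hQ : F.Q ∈ Rad l 1 := by rw [F.rad_one]; exact F.Q_mem
  rw [eq_bot_iff]
  intro K hK
  have hKd : K ∈ F.derived := by rw [← F.rad_one]; exact (hI hK).2
  by_contra hK0
  have hz : ∀ x y : l, (0 : twoCochain ℝ l a) x y = 0 := fun _ _ => rfl
  set p := F.b.coord 1 K with hp
  set q := F.b.coord 2 K with hq
  have hKpq : K = p • F.P + q • F.Q := F.eq_of_mem_derived hKd
  have hpq : p ≠ 0 ∨ q ≠ 0 := by
    by_contra hc
    push Not at hc
    exact hK0 (by rw [hKpq, hc.1, hc.2, zero_smul, zero_smul, add_zero]; exact zero_mem _)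
  have hK' : ⁅F.X, K⁆ ∈ I := I.lie_mem hK
  have e1 : (⁅F.X, (⟨K, hK⟩ : I)⁆ : I) = ⟨⁅F.X, K⁆, hK'⟩ := rfl
  have e2 : (⁅F.X, (⟨⁅F.X, K⁆, hK'⟩ : I)⁆ : I) = F.ε • ⟨K, hK⟩ :=
    Subtype.ext (F.lie_X_lie_X hKd)
  have hXK : ⁅F.X, K⁆ = (F.ε * q) • F.P + p • F.Q := by
    rw [hKpq, lie_add, lie_smul, lie_smul, F.lie_XP, F.lie_XQ]
    module
  have hαXK : α F.X K = p • α F.X F.P + q • α F.X F.Q := by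
    conv_lhs => rw [hKpq]
    simp only [map_add, map_smul]
  have hαXXK : α F.X ⁅F.X, K⁆ = ⁅F.X, α F.X K⁆ := by
    rw [hXK, hαXK, lie_add, lie_smul, lie_smul, hα.lie_XQ, ← hα.apply_XQ]
    simp only [map_add, map_smul]
    module
  -- P and Q annihilate both a and K, so the first equation gives α(P,K) = α(Q,K) = 0.
  have hPQ : α F.P F.Q = 0 := by
    have f1 : ∀ L, F.b.coord 0 L = 0 → α L K = 0 := fun L hL => by
      have := (hΦ L ⟨K, hK⟩).1
      have e0 : (⁅L, (⟨K, hK⟩ : I)⁆ : I) = 0 := Subtype.ext (by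
        show ⁅L, K⁆ = 0
        rw [F.lie_eq_of_mem_derived hKd, hL, zero_smul])
      rwa [e0, map_zero, sub_zero, F.lie_apply hs, hL, zero_smul] at this
    rcases hpq with h0 | h0
    · have f2 := f1 F.Q F.coord_Q.1
      rw [hKpq, map_add, map_smul, map_smul, twoCochain_alt, smul_zero, add_zero,
        ← twoCochain_skew] at f2
      exact neg_eq_zero.1 ((smul_eq_zero.1 f2).resolve_left h0)
    · have f2 := f1 F.P F.coord_P.1
      rw [hKpq, map_add, map_smul, map_smul, twoCochain_alt, smul_zero, zero_add] at f2
      exact (smul_eq_zero.1 f2).resolve_left h0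
  have hXK0 : α F.X K = 0 := by
    refine F.eq_zero_of_coboundary hs M (y := Φ₁ ⟨K, hK⟩) (z := Φ₁ ⟨⁅F.X, K⁆, hK'⟩) ?_ ?_ ?_
    · rw [hαXK, map_add, map_smul, map_smul, hα.apply_XQ, ← F.lie_opf, hα.opf_XP, lie_zero,
        smul_zero, smul_zero, add_zero]
    · exact (hΦ F.X ⟨K, hK⟩).1
    · have := (hΦ F.X ⟨⁅F.X, K⁆, hK'⟩).1
      rw [e2, map_smul] at this
      rw [← hαXXK]
      exact this
  -- The two terms of pα(X,P) + qα(X,Q) = 0 lie in opposite θ-eigenspaces, so each vanishes, and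
  -- ρ(X) transfers vanishing between the two values.
  have hXP : α F.X F.P = 0 ∧ α F.X F.Q = 0 := by
    have g1 := hαXK
    rw [hXK0] at g1
    have g2 := congrArg M.theta g1
    rw [map_zero, map_add, map_smul, map_smul, hα.theta_XP, hα.theta_XQ] at g2
    have g3 : p • α F.X F.P = 0 := by
      have : (2 : ℝ) • (p • α F.X F.P) = 0 := by
        calc (2 : ℝ) • (p • α F.X F.P) = (p • α F.X F.P + q • α F.X F.Q)
              + (p • α F.X F.P + q • -α F.X F.Q) := by module
          _ = 0 := by rw [← g1, ← g2, add_zero]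
      exact (smul_eq_zero.1 this).resolve_left two_ne_zero
    rw [g3, zero_add] at g1
    rcases hpq with h0 | h0
    · have := (smul_eq_zero.1 g3).resolve_left h0
      exact ⟨this, by rw [hα.apply_XQ, this, lie_zero]⟩
    · have := (smul_eq_zero.1 g1.symm).resolve_left h0
      refine ⟨?_, this⟩
      have g4 := hα.lie_XQ
      rw [this, lie_zero] at g4
      exact (smul_eq_zero.1 g4.symm).resolve_left F.ε_ne
  have hα0 : α = 0 := F.twoCochain_ext (by rw [hXP.1, hz]) (by rw [hXP.2, hz]) (by rw [hPQ, hz])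
  refine h hα0 (F.threeForm_ext ?_)
  show γ _ = 0
  -- With α = 0 and (ad X)² = ε on R₁, the equations in Φ₂ make ad X symmetric for γ(X,·,·), while
  -- tracelessness makes it skew.
  have hγ : ∀ W (hW : W ∈ Rad l 1), γ ![F.X, ⁅F.X, K⁆, W] = 0 := by
    intro W hW
    have hWd : W ∈ F.derived := by rw [← F.rad_one]; exact hW
    have hW' : ⁅F.X, W⁆ ∈ Rad l 1 := (Rad l 1).lie_mem hW
    have i1 := (hΦ F.X ⟨K, hK⟩).2 ⟨⁅F.X, W⁆, hW'⟩
    have i2 := (hΦ F.X ⟨⁅F.X, K⁆, hK'⟩).2 ⟨W, hW⟩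
    have j1 : (⁅F.X, (⟨W, hW⟩ : Rad l 1)⁆ : Rad l 1) = ⟨⁅F.X, W⁆, hW'⟩ := rfl
    have j2 : (⁅F.X, (⟨⁅F.X, W⁆, hW'⟩ : Rad l 1)⁆ : Rad l 1) = F.ε • ⟨W, hW⟩ :=
      Subtype.ext (F.lie_X_lie_X hWd)
    rw [e1, j2, map_smul] at i1
    rw [e2, j1, map_smul] at i2
    simp only [hα0, hz, map_zero, neg_zero, zero_add, LinearMap.smul_apply] at i1 i2
    have i3 : γ ![F.X, ⁅F.X, K⁆, W] = γ ![F.X, K, ⁅F.X, W⁆] := by rw [i1, i2, add_comm]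
    have i4 : γ ![F.X, ⁅F.X, K⁆, W] = -γ ![F.X, K, ⁅F.X, W⁆] := by
      rw [F.threeForm_eq γ F.X ⁅F.X, K⁆, F.threeForm_eq γ F.X K]
      simp only [vol, F.coord_one_lie, F.coord_two_lie, F.coord_zero_lie, F.coord_X,
        F.mem_derived.1 hKd, F.mem_derived.1 hWd]
      ring
    linarith
  have k1 := hγ F.P hP
  have k2 := hγ F.Q hQ
  rw [F.threeForm_eq] at k1 k2
  simp only [vol, F.coord_one_lie, F.coord_two_lie, F.coord_zero_lie, F.coord_X, F.coord_P,
    F.coord_Q, F.mem_derived.1 hKd, ← hp, ← hq] at k1 k2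
  rcases hpq with h0 | h0
  · have : γ ![F.X, F.P, F.Q] * p = 0 := by linarith
    exact (mul_eq_zero.1 this).resolve_right h0
  · have : γ ![F.X, F.P, F.Q] * (F.ε * q) = 0 := by linarith
    exact (mul_eq_zero.1 this).resolve_right (mul_ne_zero F.ε_ne h0)

end Frame

/-! ### Admissible indecomposable classes -/

namespace Frame

variable {F : Frame θ}

theorem IsHarmonic.form_XP_eq_zero {M : OrthModule θ a} {α : twoCochain ℝ l a}
    (hα : F.IsHarmonic M α) {A : a} (hA : A ∈ M.inv) : M.form A (α F.X F.P) = 0 := by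
  have h : M.form A (F.ε • α F.X F.P) = 0 := by
    rw [← hα.lie_XQ, skew_right, hA F.X, map_zero, neg_zero]
  rw [map_smul, smul_eq_mul] at h
  exact (mul_eq_zero.1 h).resolve_left F.ε_ne

theorem IsHarmonic.form_XQ_eq_zero {M : OrthModule θ a} {α : twoCochain ℝ l a}
    (hα : F.IsHarmonic M α) {A : a} (hA : A ∈ M.inv) : M.form A (α F.X F.Q) = 0 := by
  rw [hα.apply_XQ, skew_right, hA F.X, map_zero, neg_zero]

theorem IsHarmonic.form_eq_zero_of_mem_span {M : OrthModule θ a} {α : twoCochain ℝ l a}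
    {A B : a} (h₁ : M.form A (α F.X F.P) = 0) (h₂ : M.form A (α F.X F.Q) = 0)
    (hB : B ∈ Submodule.span ℝ {α F.X F.P, α F.X F.Q}) : M.form A B = 0 := by
  obtain ⟨r, s, rfl⟩ := Submodule.mem_span_pair.1 hB
  rw [map_add, map_smul, map_smul, h₁, h₂, smul_zero, smul_zero, add_zero]

variable [FiniteDimensional ℝ a]

/-- Under these hypotheses, a vector orthogonal to the values is orthogonal to N = span{α(X,P),
α(X,Q)} and to the invariants; decomposing N^⊥ further into invariants and ρ(l)a leaves only a part
inside `orth` to pair with. -/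
theorem nondegOn_orth (hs : SemisimpleModule l a) {M : OrthModule θ a}
    {α : twoCochain ℝ l a} (hα : F.IsHarmonic M α)
    (hinv : M.inv = Submodule.span ℝ {α F.P F.Q})
    (hn : M.NondegOn (Submodule.span ℝ {α F.X F.P, α F.X F.Q})) :
    M.NondegOn (F.orth hs hα).toSubmodule := by
  rw [M.nondegOn_iff]
  intro x hx hxo
  obtain ⟨h1, h2, h3⟩ := (F.mem_orth hs hα).1 hx
  have hc := LinearMap.BilinForm.isCompl_orthogonal_of_restrict_nondegenerate M.form_isRefl hn
  refine M.eq_zero_of_form_left fun D => ?_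
  have hD : D ∈ Submodule.span ℝ {α F.X F.P, α F.X F.Q}
      ⊔ M.form.orthogonal (Submodule.span ℝ {α F.X F.P, α F.X F.Q}) := by
    rw [hc.sup_eq_top]; trivial
  obtain ⟨n, hn', m, hm, rfl⟩ := Submodule.mem_sup.1 hD
  obtain ⟨i, hi, k, hk, rfl⟩ := M.exists_add_of_mem_inv_mem_moved hs m
  have hxn : M.form x n = 0 :=
    IsHarmonic.form_eq_zero_of_mem_span (by rw [M.symm, h2]) (by rw [M.symm, h3]) hn'
  have hxi : M.form x i = 0 := by
    rw [hinv] at hi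
    obtain ⟨r, rfl⟩ := Submodule.mem_span_singleton.1 hi
    rw [map_smul, M.symm, h1, smul_zero]
  have hk' : k ∈ (F.orth hs hα).toSubmodule := by
    refine (F.mem_orth hs hα).2
      ⟨M.form_eq_zero_of_mem_inv_of_mem_moved hα.mem_inv hk, ?_, ?_⟩
    · have e : M.form (α F.X F.P) (i + k) = 0 := hm _ (Submodule.subset_span (by simp))
      rwa [map_add, M.symm, hα.form_XP_eq_zero hi, zero_add] at e
    · have e : M.form (α F.X F.Q) (i + k) = 0 := hm _ (Submodule.subset_span (by simp))
      rwa [map_add, M.symm, hα.form_XQ_eq_zero hi, zero_add] at e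
  rw [map_add, map_add, hxn, hxi, hxo k hk', add_zero, add_zero]

theorem apply_PQ_of_mk_eq_mk (hs : SemisimpleModule l a) {M : OrthModule θ a}
    {α β : twoCochain ℝ l a} {γ δ : ThreeForm l} {h : IsCocycle M α γ} {h' : IsCocycle M β δ}
    (e : HQ.mk M α γ h = HQ.mk M β δ h') : β F.P F.Q = α F.P F.Q := by
  obtain ⟨τ, -, rfl, -⟩ := (F.mk_eq_mk_iff h h').1 e
  rw [add_apply_apply, F.d₁₂_PQ hs, add_zero]

theorem isAdmissible_of_isHarmonic (hs : SemisimpleModule l a) {M : OrthModule θ a}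
    {α : twoCochain ℝ l a} (hα : F.IsHarmonic M α) {γ : ThreeForm l} (h : IsCocycle M α γ)
    (hγ : α = 0 → γ ≠ 0) (hinv : M.inv = Submodule.span ℝ {α F.P F.Q})
    (hn : M.NondegOn (Submodule.span ℝ {α F.X F.P, α F.X F.Q})) :
    IsAdmissible M (HQ.mk M α γ h) := by
  refine ⟨F.condT₁, hs, α, γ, h, rfl, ?_, ?_, ?_, ?_⟩
  · rw [F.condT₂_iff hs, eq_bot_iff]
    rintro A ⟨hA, hA'⟩
    rw [SetLike.mem_coe, hinv] at hA
    rw [SetLike.mem_coe, M.mem_plus] at hA'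
    obtain ⟨r, rfl⟩ := Submodule.mem_span_singleton.1 hA
    rw [map_smul, hα.theta_PQ, smul_neg] at hA'
    have h2 : (2 : ℝ) • r • α F.P F.Q = 0 := by
      rw [two_smul]
      nth_rewrite 1 [← hA']
      exact neg_add_cancel _
    exact (smul_eq_zero.1 h2).resolve_left two_ne_zero
  -- (A₀) is vacuous: the centre of l is zero.
  · intro L hL _ _
    have h1 := hL F.X
    have h2 := congrArg (F.b.coord 2) (hL F.P)
    have h3 := congrArg (F.b.coord 1) h1
    have h4 := congrArg (F.b.coord 2) h1
    rw [F.coord_two_lie] at h2 h4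
    rw [F.coord_one_lie] at h3
    simp only [F.coord_X, F.coord_P, map_zero, zero_mul, zero_sub, one_mul, sub_zero,
      neg_eq_zero, mul_eq_zero, F.ε_ne, false_or] at h2 h3 h4
    exact F.ext_coord (by simp [h2]) (by simp [h4]) (by simp [h3])
  -- Since [P,Q] = 0, the spanning vector α(P,Q) already lies in α₀(ker [·,·]).
  · have : invKerImage M α ⊤ = M.inv := by
      refine le_antisymm inf_le_right (le_inf ?_ le_rfl)
      conv_lhs => rw [hinv]
      rw [Submodule.span_singleton_le_iff_mem]
      exact Submodule.mem_sup_left (apply_mem_kerImage trivial trivial F.lie_PQ)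
    rw [CondB₀, this]
    exact M.nondegOn_inv hs
  · intro k hk
    obtain rfl | ⟨k, rfl⟩ : k = 1 ∨ ∃ j, k = j + 2 := by
      rcases hk.eq_or_lt with h | h
      · exact Or.inl h.symm
      · exact Or.inr ⟨k - 2, by omega⟩
    · exact ⟨F.condA_one hs hα hγ, F.orth hs hα, F.isGreatest_orth hs hα,
        nondegOn_orth hs hα hinv hn⟩
    -- R_k = 0 for k ≥ 2: only the zero ideal is tested, and the whole module solves the system.
    · have hR := F.rad_eq_bot k
      refine ⟨fun I hI _ => ?_, ⊤, ⟨⟨0, fun L K B _ => ?_⟩, fun _ _ => le_top⟩, ?_⟩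
      · rw [eq_bot_iff, ← hR]
        exact hI.trans inf_le_right
      · have hK : (K : l) = 0 := (LieSubmodule.mem_bot (K : l)).1 (hR.le K.2)
        rw [hK]
        simp
      · rw [M.nondegOn_iff]
        exact fun A _ hA => M.eq_zero_of_form_left fun B => hA B trivial

/-- α(P,Q) depends only on the class, so an invariant vector split off by a decomposition is
orthogonal to α(P,Q), hence to all invariants, on which the form is non-degenerate. -/
theorem not_isDecomposable_of_inv_eq_span (hs : SemisimpleModule l a) {M : OrthModule θ a}
    {α : twoCochain ℝ l a} {γ : ThreeForm l} (h : IsCocycle M α γ)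
    (hinv : M.inv = Submodule.span ℝ {α F.P F.Q}) : ¬ IsDecomposable M (HQ.mk M α γ h) := by
  intro hd
  obtain ⟨A, hA, hA0, β, δ, h', e, hβ⟩ := F.exists_orthogonal_of_isDecomposable hd
  refine hA0 (M.nondegOn_iff.1 (M.nondegOn_inv hs) A hA fun B hB => ?_)
  rw [hinv] at hB
  obtain ⟨r, rfl⟩ := Submodule.mem_span_singleton.1 hB
  rw [map_smul, ← apply_PQ_of_mk_eq_mk hs e, hβ, smul_zero]

/-- The orthogonal complement of α(P,Q) in the invariants is non-degenerate and orthogonal to all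
values of α, so it would split off if it were non-zero. -/
theorem inv_eq_span_of_not_isDecomposable (hs : SemisimpleModule l a) {M : OrthModule θ a}
    {α : twoCochain ℝ l a} (hα : F.IsHarmonic M α) {γ : ThreeForm l} (h : IsCocycle M α γ)
    (hd : ¬ IsDecomposable M (HQ.mk M α γ h)) (hplus : M.inv ⊓ M.plus = ⊥)
    (hPQ : M.form (α F.P F.Q) (α F.P F.Q) = 0 → α F.P F.Q = 0) :
    M.inv = Submodule.span ℝ {α F.P F.Q} := by
  have : FiniteDimensional ℝ l := Module.Finite.of_basis F.b
  have : Nontrivial l := ⟨⟨F.X, 0, F.b.ne_zero 0⟩⟩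
  have hsplit : ∀ B ∈ M.inv, ∃ r : ℝ, ∃ C ∈ M.inv ⊓ LinearMap.ker (M.form (α F.P F.Q)),
      B = r • α F.P F.Q + C := by
    intro B hB
    -- Orthogonal projection onto α(P,Q). If the denominator is 0, then α(P,Q) = 0 by `hPQ` and the
    -- projection is harmlessly zero.
    refine ⟨M.form (α F.P F.Q) B / M.form (α F.P F.Q) (α F.P F.Q),
      B - (M.form (α F.P F.Q) B / M.form (α F.P F.Q) (α F.P F.Q)) • α F.P F.Q,
      ⟨M.inv.sub_mem hB (M.inv.smul_mem _ hα.mem_inv), ?_⟩, by abel⟩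
    show M.form _ _ = 0
    rw [map_sub, map_smul, smul_eq_mul]
    by_cases h0 : M.form (α F.P F.Q) (α F.P F.Q) = 0
    · rw [hPQ h0]; simp
    · field_simp
      ring
  have hV : M.inv ⊓ LinearMap.ker (M.form (α F.P F.Q)) = ⊥ := by
    by_contra hV
    refine hd (isDecomposable_of_orthogonal hV ?_ inf_le_left ?_ h ?_)
    · rw [M.nondegOn_iff]
      rintro A ⟨hA, hA'⟩ hAV
      refine M.nondegOn_iff.1 (M.nondegOn_inv hs) A hA fun B hB => ?_
      obtain ⟨r, C, hC, rfl⟩ := hsplit B hB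
      have hA2 : M.form (α F.P F.Q) A = 0 := hA'
      rw [map_add, map_smul, M.symm, hA2, hAV C hC, smul_zero, add_zero]
    · intro A hA
      -- As there are no θ-fixed invariants, θ = -1 on the invariants, and every subspace of them is
      -- θ-stable.
      have h1 : A + M.theta A ∈ M.inv ⊓ M.plus :=
        ⟨M.inv.add_mem hA.1 (M.theta_mem_inv hA.1), by
          rw [SetLike.mem_coe, M.mem_plus, map_add, M.theta_invol, add_comm]⟩
      rw [hplus, Submodule.mem_bot, add_comm, ← eq_neg_iff_add_eq_zero] at h1
      rw [h1]
      exact Submodule.neg_mem _ hA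
    · rintro x y A ⟨hA, hA'⟩
      have hA2 : M.form (α F.P F.Q) A = 0 := hA'
      rw [F.twoCochain_eq α x y]
      simp only [map_add, map_smul, hα.form_XP_eq_zero hA, hα.form_XQ_eq_zero hA,
        M.symm A (α F.P F.Q), hA2, smul_zero, add_zero]
  apply le_antisymm
  · intro B hB
    obtain ⟨r, C, hC, rfl⟩ := hsplit B hB
    rw [hV, Submodule.mem_bot] at hC
    rw [hC, add_zero]
    exact Submodule.smul_mem _ _ (Submodule.mem_span_singleton_self _)
  · rw [Submodule.span_singleton_le_iff_mem]
    exact hα.mem_inv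

/-- Admissibility is witnessed by some representative β, but 𝔟₁ depends only on the class and hence
equals `orth` of the harmonic α. An isotropic α(P,Q), or a radical vector of span{α(X,P), α(X,Q)},
would lie in the radical of `orth`. -/
theorem inv_eq_span_and_nondegOn_of_mem (hs : SemisimpleModule l a) {M : OrthModule θ a}
    {α : twoCochain ℝ l a} (hα : F.IsHarmonic M α) {γ : ThreeForm l} (h : IsCocycle M α γ)
    (hmem : HQ.mk M α γ h ∈ HQ₀ M) : M.inv = Submodule.span ℝ {α F.P F.Q} ∧
      M.NondegOn (Submodule.span ℝ {α F.X F.P, α F.X F.Q}) := by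
  obtain ⟨⟨-, -, β, δ, h', e, hT, -, -, hAB⟩, hd⟩ := hmem
  obtain ⟨τ, -, hβ, -⟩ := (F.mk_eq_mk_iff h h').1 e
  rw [F.condT₂_iff hs] at hT
  obtain ⟨-, b, hb, hbn⟩ := hAB 1 le_rfl
  have hset : {b | SolvableOn M β 1 b} = {b | SolvableOn M α 1 b} := by
    have hR : ∀ K ∈ Rad l 1, ∀ A : a, ⁅K, A⁆ = 0 := fun K hK A => F.lie_eq_zero_of_mem_rad hs hK A
    ext b
    refine ⟨fun hb => solvableOn_of_eq_add (τ := -τ) ?_ hR hb,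
      fun hb => solvableOn_of_eq_add hβ hR hb⟩
    rw [hβ, map_neg]
    exact (add_neg_cancel_right α (d₁₂ ℝ l a τ)).symm
  rw [hset] at hb
  rw [hb.unique (F.isGreatest_orth hs hα), M.nondegOn_iff] at hbn
  refine ⟨inv_eq_span_of_not_isDecomposable hs hα h hd hT fun h0 => ?_, ?_⟩
  · refine hbn _ ((F.mem_orth hs hα).2 ⟨h0, ?_, ?_⟩) fun B hB => ((F.mem_orth hs hα).1 hB).1
    · rw [M.symm, hα.form_XP_eq_zero hα.mem_inv]
    · rw [M.symm, hα.form_XQ_eq_zero hα.mem_inv]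
  · rw [M.nondegOn_iff]
    intro A hA hAN
    refine hbn A ((F.mem_orth hs hα).2 ⟨?_, ?_, ?_⟩) fun B hB => ?_
    · exact IsHarmonic.form_eq_zero_of_mem_span (hα.form_XP_eq_zero hα.mem_inv)
        (hα.form_XQ_eq_zero hα.mem_inv) hA
    · rw [M.symm]; exact hAN _ (Submodule.subset_span (by simp))
    · rw [M.symm]; exact hAN _ (Submodule.subset_span (by simp))
    · obtain ⟨-, h2, h3⟩ := (F.mem_orth hs hα).1 hB
      rw [M.symm]
      exact IsHarmonic.form_eq_zero_of_mem_span (by rw [M.symm, h2]) (by rw [M.symm, h3]) hA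

/-- The zero class is not admissible. -/
theorem not_isAdmissible_zero (hs : SemisimpleModule l a) (F : Frame θ) {M : OrthModule θ a}
    (h : IsCocycle M 0 0) : ¬ IsAdmissible M (HQ.mk M 0 0 h) := by
  rintro ⟨-, -, β, δ, h', e, -, -, -, hAB⟩
  obtain ⟨τ, -, hβ, hδ⟩ := (F.mk_eq_mk_iff h h').1 e
  rw [zero_add] at hβ
  have hA := (hAB 1 le_rfl).1
  rw [hβ] at hA
  have hbot := rad_one_eq_bot_of_condA (fun K hK A => F.lie_eq_zero_of_mem_rad hs hK A)
    (fun K hK W hW => ?_) (by rw [F.rad_one]; exact F.derived_le_soc) (fun x y z => ?_) hA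
  · have hP := F.P_mem
    rw [← F.rad_one, hbot, LieSubmodule.mem_bot] at hP
    exact F.b.ne_zero 1 hP
  · rw [F.rad_one] at hK hW
    rw [F.lie_eq_of_mem_derived hW, F.mem_derived.1 hK, zero_smul]
  · rw [F.threeForm_eq, hδ, F.wedgeTwoOne_eq M _ τ x y z, zero_add]
    show (0 + _) * _ = _
    rw [zero_add]

/-- The classification of the quadratic cohomology classes of a frame, and of the admissible
indecomposable ones among them. -/
theorem classification (F : Frame θ) (hs : SemisimpleModule l a) (M : OrthModule θ a)
    (S : Submodule ℝ (twoCochain ℝ l a)) (hS : ∀ α, α ∈ S ↔ F.IsHarmonic M α) :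
    ∃ (hZ : ∀ α ∈ S, IsCocycle M α 0) (hC : ∀ γ : ThreeForm l, IsCocycle M 0 γ),
      Function.Bijective (Sum.elim
        (fun α : {α : twoCochain ℝ l a // α ∈ S ∧ α ≠ 0} => HQ.mk M α.1 0 (hZ α.1 α.2.1))
        (fun γ : ThreeForm l => HQ.mk M 0 γ (hC γ))) ∧
      (∀ (α : twoCochain ℝ l a) (hα : α ∈ S), α ≠ 0 → (HQ.mk M α 0 (hZ α hα) ∈ HQ₀ M ↔
        M.inv = Submodule.span ℝ {α F.P F.Q} ∧
        M.NondegOn (Submodule.span ℝ {α F.X F.P, α F.X F.Q}))) ∧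
      (∀ γ : ThreeForm l, HQ.mk M 0 γ (hC γ) ∈ HQ₀ M ↔ M.inv = ⊥ ∧ γ ≠ 0) := by
  have hZ : ∀ α ∈ S, IsCocycle M α 0 := fun α hα => ((hS α).1 hα).isCocycle hs 0
  have hC : ∀ γ : ThreeForm l, IsCocycle M 0 γ := fun γ => (F.isHarmonic_zero M).isCocycle hs γ
  have hz : ∀ x y : l, (0 : twoCochain ℝ l a) x y = 0 := fun _ _ => rfl
  refine ⟨hZ, hC, F.bijective_elim hs M S hS hZ hC, fun α hα h0 => ?_, fun γ => ?_⟩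
  · have hα' := (hS α).1 hα
    exact ⟨inv_eq_span_and_nondegOn_of_mem hs hα' _, fun h =>
      ⟨isAdmissible_of_isHarmonic hs hα' _ (fun h1 => absurd h1 h0) h.1 h.2,
        not_isDecomposable_of_inv_eq_span hs _ h.1⟩⟩
  · have h0 := F.isHarmonic_zero M
    constructor
    · intro h
      have h1 := (inv_eq_span_and_nondegOn_of_mem hs h0 _ h).1
      rw [hz, Submodule.span_zero_singleton] at h1
      refine ⟨h1, ?_⟩
      rintro rfl
      exact not_isAdmissible_zero hs F _ h.1
    · rintro ⟨h1, h2⟩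
      have h3 : M.inv = Submodule.span ℝ {(0 : twoCochain ℝ l a) F.P F.Q} := by
        rw [h1, hz, Submodule.span_zero_singleton]
      refine ⟨isAdmissible_of_isHarmonic hs h0 _ (fun _ => h2) h3 ?_,
        not_isDecomposable_of_inv_eq_span hs _ h3⟩
      rw [hz, hz, M.nondegOn_iff]
      intro A hA _
      simpa using hA

end Frame

end General

/-! ### Real elements of the weight spaces -/

/-- The map z ⊗ A ↦ Re(z)A is a left inverse. -/
theorem one_tmul_injective {a : Type v} [AddCommGroup a] [Module ℝ a] {A B : a}
    (h : (1 : ℂ) ⊗ₜ[ℝ] A = (1 : ℂ) ⊗ₜ[ℝ] B) : A = B := by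
  have := congrArg (TensorProduct.lift (LinearMap.lsmul ℝ a ∘ₗ Complex.reLm)) h
  simpa using this

/-! ### The frame of 𝔯_{3,-1} and its harmonic cochains -/

namespace R31

@[simp] theorem neg_apply (s : R31) (i : Fin 3) : (-s) i = -s i := rfl
@[simp] theorem sub_apply (s t : R31) (i : Fin 3) : (s - t) i = s i - t i := rfl

/-- The basis `X, Y - Z, Y + Z`. -/
noncomputable def basis : Module.Basis (Fin 3) ℝ R31 := Module.Basis.ofEquivFun
  { toFun := fun s => ![s 0, (s 1 - s 2) / 2, (s 1 + s 2) / 2]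
    invFun := fun c => vec (c 0) (c 1 + c 2) (c 2 - c 1)
    map_add' := fun s t => by ext i; fin_cases i <;> simp <;> ring
    map_smul' := fun r s => by ext i; fin_cases i <;> simp <;> ring
    left_inv := fun s => by apply ext3 <;> simp <;> ring
    right_inv := fun c => by ext i; fin_cases i <;> simp <;> ring }

theorem basis_zero : basis 0 = X := by
  rw [basis, Module.Basis.coe_ofEquivFun]
  apply ext3 <;> simp [X]

theorem basis_one : basis 1 = Y - Z := by
  rw [basis, Module.Basis.coe_ofEquivFun]
  apply ext3 <;> simp [Y, Z]

theorem basis_two : basis 2 = Y + Z := by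
  rw [basis, Module.Basis.coe_ofEquivFun]
  apply ext3 <;> simp [Y, Z]

theorem theta_apply (s : R31) : theta.toHom s = vec (-s 0) (s 2) (s 1) := rfl

/-- The frame `X, Y - Z, Y + Z`. -/
noncomputable def frame : Frame theta where
  ε := 1
  ε_ne := one_ne_zero
  b := basis
  lie_XP := by rw [basis_zero, basis_one, basis_two]; apply ext3 <;> simp [X, Y, Z]
  lie_XQ := by rw [basis_zero, basis_one, basis_two]; apply ext3 <;> simp [X, Y, Z]
  lie_PQ := by rw [basis_one, basis_two]; apply ext3 <;> simp [Y, Z]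
  theta_X := by
    rw [basis_zero, theta_apply]; apply ext3 <;> simp [X]
  theta_P := by
    rw [basis_one, theta_apply]; apply ext3 <;> simp [Y, Z]
  theta_Q := by
    rw [basis_two, theta_apply]; apply ext3 <;> simp [Y, Z]

variable {a : Type v} [AddCommGroup a] [Module ℝ a] [LieRingModule R31 a] [LieModule ℝ R31 a]

theorem one_tmul_mem_E_iff {A : a} : (1 : ℂ) ⊗ₜ[ℝ] A ∈ E a 1 ↔ ∀ L : R31, ⁅L, A⁆ = L 0 • A := by
  have h : ∀ L : R31, (LieModule.toEnd ℝ R31 a L).baseChange ℂ ((1 : ℂ) ⊗ₜ[ℝ] A)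
      = weight 1 L • ((1 : ℂ) ⊗ₜ[ℝ] A) ↔ ⁅L, A⁆ = L 0 • A := by
    intro L
    have e : weight 1 L • ((1 : ℂ) ⊗ₜ[ℝ] A) = (1 : ℂ) ⊗ₜ[ℝ] (L 0 • A) := by
      rw [TensorProduct.tmul_smul, TensorProduct.smul_tmul', TensorProduct.smul_tmul',
        Complex.real_smul]
      simp [weight]
    rw [e, LinearMap.baseChange_tmul]
    exact ⟨one_tmul_injective, fun h => congrArg _ h⟩
  exact forall_congr' h

omit [LieRingModule R31 a] [LieModule ℝ R31 a] in
theorem twoCochain_frame (α : twoCochain ℝ R31 a) :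
    α frame.X frame.P = α X Y - α X Z ∧ α frame.X frame.Q = α X Y + α X Z ∧
      α frame.P frame.Q = (2 : ℝ) • α Y Z := by
  have h0 : frame.X = X := basis_zero
  have h1 : frame.P = Y - Z := basis_one
  have h2 : frame.Q = Y + Z := basis_two
  rw [h0, h1, h2]
  refine ⟨map_sub _ _ _, map_add _ _ _, ?_⟩
  simp only [map_add, map_sub, LinearMap.sub_apply, twoCochain_alt, ← twoCochain_skew α Y Z]
  module

/-- With A = α(X,Y) and α(X,Z) = -θA, the values at X, P and X, Q are A + θA and A - θA. As ρ(X)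
anticommutes with θ, ρ(X)A = A makes θA an eigenvector for -1; conversely A is half the sum of the
two values. -/
theorem mem_ZSpace_iff [FiniteDimensional ℝ a] (hs : SemisimpleModule R31 a)
    (M : OrthModule theta a) (α : twoCochain ℝ R31 a) :
    α ∈ ZSpace M ↔ frame.IsHarmonic M α := by
  have hX : frame.X = X := basis_zero
  obtain ⟨e1, e2, e3⟩ := twoCochain_frame α
  have hE : (∀ L : R31, ⁅L, α X Y⁆ = L 0 • α X Y) ↔ ⁅X, α X Y⁆ = α X Y := by
    have h0 : ∀ L : R31, L 0 = frame.b.coord 0 L := fun L => by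
      show L 0 = basis.coord 0 L
      simp [basis, Module.Basis.coord_apply]
    refine ⟨fun h => ?_, fun h L => ?_⟩
    · rw [h X]; exact one_smul ℝ _
    · rw [frame.lie_apply hs, hX, h]
      exact congrArg (· • α X Y) (h0 L).symm
  have hopf : ∀ A, frame.opf a A = ⁅X, ⁅X, A⁆⁆ - A := fun A => by
    rw [Frame.opf_apply, hX]
    exact congrArg _ (one_smul ℝ A)
  have hθX : ∀ A, M.theta ⁅X, A⁆ = -⁅X, M.theta A⁆ := fun A => by
    rw [← hX]; exact frame.theta_lie_X M A
  constructor
  · rintro ⟨⟨h1, h2⟩, h3, h4⟩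
    rw [one_tmul_mem_E_iff, hE] at h3
    rw [SetLike.mem_coe, M.mem_minus] at h2
    have h5 : α X Z = -M.theta (α X Y) := by rw [h4, neg_neg]
    have h6 : ⁅X, M.theta (α X Y)⁆ = -M.theta (α X Y) := by
      rw [← neg_eq_iff_eq_neg, ← hθX, h3]
    constructor
    · rw [e3]; exact M.inv.smul_mem _ h1
    · rw [e3, map_smul, h2, smul_neg]
    · rw [e1, h5, sub_neg_eq_add, map_add, M.theta_invol, add_comm]
    · rw [hopf, e1, h5, sub_neg_eq_add, lie_add, h3, h6, lie_add, lie_neg, h3, h6, neg_neg,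
        sub_self]
    · rw [e1, e2, h5, hX, sub_neg_eq_add, lie_add, h3, h6]
  · intro h
    have h1 := h.opf_XP
    have h2 := h.apply_XQ
    have h3 := h.theta_XP
    have h4 := h.theta_XQ
    have h5 := h.theta_PQ
    rw [hopf, sub_eq_zero, ← hX, ← h2] at h1
    have f1 : α X Y = (1 / 2 : ℝ) • (α frame.X frame.P + α frame.X frame.Q) := by
      rw [e1, e2]; module
    have f2 : α X Z = (1 / 2 : ℝ) • (α frame.X frame.Q - α frame.X frame.P) := by
      rw [e1, e2]; module
    have f3 : α Y Z = (1 / 2 : ℝ) • α frame.P frame.Q := by rw [e3]; module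
    refine ⟨⟨?_, ?_⟩, ?_, ?_⟩
    · rw [f3]; exact M.inv.smul_mem _ h.mem_inv
    · rw [SetLike.mem_coe, M.mem_minus, f3, map_smul, h5, smul_neg]
    · rw [one_tmul_mem_E_iff, hE, f1, ← hX, lie_smul, lie_add, h1, ← h2, add_comm]
    · rw [f1, f2, map_smul, map_add, h3, h4]; module

omit [LieRingModule R31 a] [LieModule ℝ R31 a] in
theorem span_frame (α : twoCochain ℝ R31 a) :
    Submodule.span ℝ {α frame.P frame.Q} = Submodule.span ℝ {α Y Z} ∧
    Submodule.span ℝ {α frame.X frame.P, α frame.X frame.Q}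
      = Submodule.span ℝ {α X Y, α X Z} := by
  obtain ⟨e1, e2, e3⟩ := twoCochain_frame α
  rw [e1, e2, e3]
  refine ⟨Submodule.span_singleton_smul_eq (IsUnit.mk0 _ two_ne_zero) _, ?_⟩
  ext A
  simp only [Submodule.mem_span_pair]
  constructor
  · rintro ⟨r, s, rfl⟩
    exact ⟨r + s, s - r, by module⟩
  · rintro ⟨r, s, rfl⟩
    exact ⟨(r - s) / 2, (r + s) / 2, by module⟩

end R31

/-! ### The frame of 𝔫(2) and its harmonic cochains -/

namespace N2

@[simp] theorem neg_apply (s : N2) (i : Fin 3) : (-s) i = -s i := rfl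

/-- The basis `X, Y, Z`. -/
noncomputable def basis : Module.Basis (Fin 3) ℝ N2 := Module.Basis.ofEquivFun
  { toFun := fun s => ![s 0, s 1, s 2]
    invFun := fun c => vec (c 0) (c 1) (c 2)
    map_add' := fun s t => by ext i; fin_cases i <;> simp
    map_smul' := fun r s => by ext i; fin_cases i <;> simp
    left_inv := fun s => by apply ext3 <;> simp
    right_inv := fun c => by ext i; fin_cases i <;> simp }

theorem basis_zero : basis 0 = X := by
  rw [basis, Module.Basis.coe_ofEquivFun]
  apply ext3 <;> simp [X]

theorem basis_one : basis 1 = Y := by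
  rw [basis, Module.Basis.coe_ofEquivFun]
  apply ext3 <;> simp [Y]

theorem basis_two : basis 2 = Z := by
  rw [basis, Module.Basis.coe_ofEquivFun]
  apply ext3 <;> simp [Z]

theorem theta_apply (s : N2) : theta.toHom s = vec (-s 0) (-s 1) (s 2) := rfl

/-- The frame `X, Y, Z`. -/
noncomputable def frame : Frame theta where
  ε := -1
  ε_ne := neg_ne_zero.2 one_ne_zero
  b := basis
  lie_XP := by rw [basis_zero, basis_one, basis_two]; apply ext3 <;> simp [X, Y, Z]
  lie_XQ := by rw [basis_zero, basis_one, basis_two]; apply ext3 <;> simp [X, Y, Z]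
  lie_PQ := by rw [basis_one, basis_two]; apply ext3 <;> simp [Y, Z]
  theta_X := by
    rw [basis_zero, theta_apply]; apply ext3 <;> simp [X]
  theta_P := by
    rw [basis_one, theta_apply]; apply ext3 <;> simp [Y]
  theta_Q := by
    rw [basis_two, theta_apply]; apply ext3 <;> simp [Z]

variable {a : Type v} [AddCommGroup a] [Module ℝ a] [LieRingModule N2 a] [LieModule ℝ N2 a]

/-- ρ(X)² = -1 on both weight spaces, as (±i)² = -1. -/
theorem lie_lie_of_mem_E {A : a} (h : (1 : ℂ) ⊗ₜ[ℝ] A ∈ E a) : ⁅X, ⁅X, A⁆⁆ = -A := by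
  obtain ⟨B, hB, C, hC, hBC⟩ := Submodule.mem_sup.1 h
  set T := (LieModule.toEnd ℝ N2 a X).baseChange ℂ with hT
  have hw : ∀ c : ℂ, weight c X = c := fun c => by simp [weight, X]
  have hB' : T B = Complex.I • B := by rw [← hw Complex.I]; exact hB X
  have hC' : T C = (-Complex.I) • C := by rw [← hw (-Complex.I)]; exact hC X
  have h1 : T (T (B + C)) = -(B + C) := by
    rw [map_add, hB', hC', map_add, map_smul, map_smul, hB', hC', smul_smul, smul_smul,
      neg_mul_neg, Complex.I_mul_I]
    module
  rw [hBC, hT, LinearMap.baseChange_tmul, LinearMap.baseChange_tmul,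
    ← TensorProduct.tmul_neg] at h1
  exact one_tmul_injective h1

/-- If ρ(X)²A = -A, then 1 ⊗ A - c ⊗ ρ(X)A is an eigenvector of ρ(X) with eigenvalue c for c = ±i,
and 1 ⊗ A is the mean of the two. -/
theorem mem_E_of_lie_lie {A : a} (hL : ∀ (L : N2) (B : a), ⁅L, B⁆ = L 0 • ⁅X, B⁆)
    (h : ⁅X, ⁅X, A⁆⁆ = -A) : (1 : ℂ) ⊗ₜ[ℝ] A ∈ E a := by
  have hw : ∀ c : ℂ, c * c = -1 →
      (1 : ℂ) ⊗ₜ[ℝ] A - c ⊗ₜ[ℝ] ⁅X, A⁆ ∈ weightSpace a (weight c) := by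
    intro c hc L
    have hr : ∀ (z : ℂ) (r : ℝ) (B : a), z ⊗ₜ[ℝ] (r • B) = ((r : ℂ) * z) ⊗ₜ[ℝ] B := fun z r B => by
      rw [TensorProduct.tmul_smul, TensorProduct.smul_tmul', Complex.real_smul]
    rw [map_sub, LinearMap.baseChange_tmul, LinearMap.baseChange_tmul,
      LieModule.toEnd_apply_apply, LieModule.toEnd_apply_apply, hL L, hL L, h, hr, hr, smul_sub,
      TensorProduct.smul_tmul', TensorProduct.smul_tmul', TensorProduct.tmul_neg]
    have e1 : weight c L • (1 : ℂ) = (L 0 : ℂ) * c := by simp [weight]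
    have e2 : weight c L • c = -((L 0 : ℂ) * 1) := by
      rw [smul_eq_mul]
      show (L 0 : ℂ) * c * c = _
      rw [mul_assoc, hc]
      ring
    rw [e1, e2, TensorProduct.neg_tmul]
    abel
  have h1 := hw Complex.I Complex.I_mul_I
  have h2 := hw (-Complex.I) (by rw [neg_mul_neg, Complex.I_mul_I])
  have e : (1 : ℂ) ⊗ₜ[ℝ] A = (1 / 2 : ℂ) • ((1 : ℂ) ⊗ₜ[ℝ] A - Complex.I ⊗ₜ[ℝ] ⁅X, A⁆)
      + (1 / 2 : ℂ) • ((1 : ℂ) ⊗ₜ[ℝ] A - (-Complex.I) ⊗ₜ[ℝ] ⁅X, A⁆) := by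
    rw [TensorProduct.neg_tmul]
    module
  rw [e]
  exact Submodule.add_mem_sup (Submodule.smul_mem _ _ h1) (Submodule.smul_mem _ _ h2)

theorem mem_ZSpace_iff [FiniteDimensional ℝ a] (hs : SemisimpleModule N2 a)
    (M : OrthModule theta a) (α : twoCochain ℝ N2 a) :
    α ∈ ZSpace M ↔ frame.IsHarmonic M α := by
  have hX : frame.X = X := basis_zero
  have hP : frame.P = Y := basis_one
  have hQ : frame.Q = Z := basis_two
  have hL : ∀ (L : N2) (B : a), ⁅L, B⁆ = L 0 • ⁅X, B⁆ := fun L B => by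
    have h0 : L 0 = frame.b.coord 0 L := by
      show L 0 = basis.coord 0 L
      simp [basis, Module.Basis.coord_apply]
    rw [frame.lie_apply hs, hX, h0]
  have hopf : ∀ A, frame.opf a A = 0 ↔ ⁅X, ⁅X, A⁆⁆ = -A := fun A => by
    rw [Frame.opf_apply, hX, sub_eq_zero]
    show _ = (-1 : ℝ) • A ↔ _
    rw [neg_one_smul]
  constructor
  · rintro ⟨⟨h1, h2⟩, h3, h4, h5⟩
    rw [SetLike.mem_coe, M.mem_minus] at h2
    rw [M.mem_plus] at h4
    exact ⟨by rwa [hP, hQ], by rwa [hP, hQ], by rwa [hX, hP],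
      by rw [hopf, hX, hP]; exact lie_lie_of_mem_E h3, by rw [hX, hP, hQ]; exact h5⟩
  · rintro ⟨h1, h2, h3, h4, h5⟩
    rw [hopf] at h4
    rw [hX, hP] at h3 h4
    rw [hP, hQ] at h1 h2
    rw [hX, hP, hQ] at h5
    exact ⟨⟨h1, M.mem_minus.2 h2⟩, mem_E_of_lie_lie hL h4, M.mem_plus.2 h3, h5⟩

end N2

end QuadCoh

theorem proposition6p3 :
    (∀ (a : Type v) [AddCommGroup a] [Module ℝ a] [FiniteDimensional ℝ a]
        [LieRingModule R31 a] [LieModule ℝ R31 a] (M : OrthModule R31.theta a),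
      SemisimpleModule R31 a →
      ∃ (hZ : ∀ α ∈ R31.ZSpace M, IsCocycle M α 0) (hC : ∀ γ : ThreeForm R31, IsCocycle M 0 γ),
        Function.Bijective (Sum.elim
          (fun α : {α : twoCochain ℝ R31 a // α ∈ R31.ZSpace M ∧ α ≠ 0} =>
            HQ.mk M α.1 0 (hZ α.1 α.2.1))
          (fun γ : ThreeForm R31 => HQ.mk M 0 γ (hC γ))) ∧
        (∀ (α : twoCochain ℝ R31 a) (hα : α ∈ R31.ZSpace M), α ≠ 0 →
          (HQ.mk M α 0 (hZ α hα) ∈ HQ₀ M ↔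
            M.inv = Submodule.span ℝ {α R31.Y R31.Z} ∧
            M.NondegOn (Submodule.span ℝ {α R31.X R31.Y, α R31.X R31.Z}))) ∧
        (∀ γ : ThreeForm R31, HQ.mk M 0 γ (hC γ) ∈ HQ₀ M ↔ M.inv = ⊥ ∧ γ ≠ 0)) ∧
    (∀ (a : Type v) [AddCommGroup a] [Module ℝ a] [FiniteDimensional ℝ a]
        [LieRingModule N2 a] [LieModule ℝ N2 a] (M : OrthModule N2.theta a),
      SemisimpleModule N2 a →
      ∃ (hZ : ∀ α ∈ N2.ZSpace M, IsCocycle M α 0) (hC : ∀ γ : ThreeForm N2, IsCocycle M 0 γ),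
        Function.Bijective (Sum.elim
          (fun α : {α : twoCochain ℝ N2 a // α ∈ N2.ZSpace M ∧ α ≠ 0} =>
            HQ.mk M α.1 0 (hZ α.1 α.2.1))
          (fun γ : ThreeForm N2 => HQ.mk M 0 γ (hC γ))) ∧
        (∀ (α : twoCochain ℝ N2 a) (hα : α ∈ N2.ZSpace M), α ≠ 0 →
          (HQ.mk M α 0 (hZ α hα) ∈ HQ₀ M ↔
            M.inv = Submodule.span ℝ {α N2.Y N2.Z} ∧
            M.NondegOn (Submodule.span ℝ {α N2.X N2.Y, α N2.X N2.Z}))) ∧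
        (∀ γ : ThreeForm N2, HQ.mk M 0 γ (hC γ) ∈ HQ₀ M ↔ M.inv = ⊥ ∧ γ ≠ 0)) := by
  refine ⟨fun a _ _ _ _ _ M hs => ?_, fun a _ _ _ _ _ M hs => ?_⟩
  · obtain ⟨hZ, hC, h1, h2, h3⟩ :=
      R31.frame.classification hs M (R31.ZSpace M) (R31.mem_ZSpace_iff hs M)
    refine ⟨hZ, hC, h1, fun α hα h0 => ?_, h3⟩
    rw [← (R31.span_frame α).1, ← (R31.span_frame α).2]
    exact h2 α hα h0
  · obtain ⟨hZ, hC, h1, h2, h3⟩ :=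
      N2.frame.classification hs M (N2.ZSpace M) (N2.mem_ZSpace_iff hs M)
    refine ⟨hZ, hC, h1, fun α hα h0 => ?_, h3⟩
    have hX : N2.frame.X = N2.X := N2.basis_zero
    have hP : N2.frame.P = N2.Y := N2.basis_one
    have hQ : N2.frame.Q = N2.Z := N2.basis_two
    rw [← hX, ← hP, ← hQ]
    exact h2 α hα h0
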